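/- Let $s>0$, $-1\le e_1<1<e_4$ be real, let $R(u)=4(u-e_1)(u^2-e_4^2)$, and let $C_{\mathrm{aper}}$ be the elliptic curve $w^2=R(u)$ (the aperiodic case $e_2=e_3=1$). Let $2\omega_1,2\omega_2$ be the periods of $du/w$ over cycles around $e_1,e_4$ and around $-e_4,e_1$ respectively, that is $$\omega_1=\pm i\int_{e_1}^{e_4}\frac{du}{\sqrt{-R(u)}},\qquad \omega_2=\pm\int_{-e_4}^{e_1}\frac{du}{\sqrt{R(u)}},\qquad \omega_3=\omega_1+\omega_2$$ (any choice of signs), and let $\zeta,\sigma$ be the Weierstrass functions of the lattice $2\omega_1\mathbb Z+2\omega_2\mathbb Z$. Along a continuously differentiable path on the affine curve $C_{\mathrm{aper}}$ that starts at $(u,w)=(e_1,0)$ put $$x=\int\frac{du}{w},\qquad t=i\sqrt{2s}\int\frac{u^2-e_4^2}{u-1}\,\frac{du}{w},$$ so that $t=0$ at $x=0$; for $t$ the path is required to avoid the points over $u=1$. Let $w_{+1}$ be one of the two values of $w$ over $u=1$, and let $b$ be a point of the $x$-plane corresponding to $(u,w)=(1,w_{+1})$, i.e. $b=\int du/w$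 along some such path from $(e_1,0)$ to $(1,w_{+1})$. Then these integrals converge, and along every path avoiding the points over $u=1$, $$\frac{t}{i\sqrt{2s}}=-\zeta(x-\omega_3)-\zeta(\omega_3)+\Big(1+\frac{e_1}{3}\Big)x+\frac{1-e_4^2}{w_{+1}}\left(\log\Big(-\frac{\sigma(x-b)}{\sigma(x+b)}\Big)+2\big(\zeta(\omega_3)+\zeta(b-\omega_3)\big)x\right),$$ where the logarithm denotes the branch, continued continuously along the path, that is zero at $x=0$. -/

import Mathlib

open Set

namespace PeriodPair

/-- The Weierstrass zeta function of the lattice `L`,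
`ζ(z) = 1/z + ∑_{l ≠ 0} (1/(z - l) + 1/l + z/l²)`.
The term `l = 0` of the sum below is `1/z`, because `1/0 = z/0 = 0`. -/
noncomputable def weierstrassZeta (L : PeriodPair) (z : ℂ) : ℂ :=
  ∑' l : L.lattice, (1 / (z - l) + 1 / (l : ℂ) + z / (l : ℂ) ^ 2)

/-- The Weierstrass sigma function of the lattice `L`,
`σ(z) = z ∏_{l ≠ 0} (1 - z/l) exp(z/l + z²/(2l²))`.
The factor `l = 0` of the product below is `1`, because `z/0 = 0`. -/
noncomputable def weierstrassSigma (L : PeriodPair) (z : ℂ) : ℂ :=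
  z * ∏' l : L.lattice,
    ((1 - z / (l : ℂ)) * Complex.exp (z / (l : ℂ) + z ^ 2 / (2 * (l : ℂ) ^ 2)))

end PeriodPair

namespace AperiodicTop

/-- The cubic `R(u) = 4 (u - e₁) (u² - e₄²)`. -/
def cubic {K : Type*} [Field K] (e₁ e₄ u : K) : K := 4 * (u - e₁) * (u ^ 2 - e₄ ^ 2)

/-- The modulus of the imaginary half period: half the integral of `du / w` over a cycle
around the branch points `e₁` and `e₄`, where `R < 0` in between. -/
noncomputable def imagHalfPeriod (e₁ e₄ : ℝ) : ℝ :=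
  ∫ u in e₁..e₄, 1 / Real.sqrt (-cubic e₁ e₄ u)

/-- The modulus of the real half period: half the integral of `du / w` over a cycle
around the branch points `-e₄` and `e₁`, where `R > 0` in between. -/
noncomputable def realHalfPeriod (e₁ e₄ : ℝ) : ℝ :=
  ∫ u in (-e₄)..e₁, 1 / Real.sqrt (cubic e₁ e₄ u)

theorem intervalIntegrable_arcsine {a b : ℝ} (hab : a < b) :
    IntervalIntegrable (fun u : ℝ => 1 / Real.sqrt ((u - a) * (b - u))) MeasureTheory.volume a b := by
  have hc : 0 < b - a := sub_pos.mpr hab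
  refine intervalIntegral.intervalIntegrable_deriv_of_nonneg
    (g := fun u => Real.arcsin ((2 * u - a - b) / (b - a))) ?_ ?_ ?_
  · exact (Real.continuous_arcsin.comp (by fun_prop)).continuousOn
  · intro u hu
    rw [min_eq_left hab.le, max_eq_right hab.le] at hu
    have h1 : (2 * u - a - b) / (b - a) ≠ -1 := by
      rw [Ne, div_eq_iff hc.ne']; intro h; linarith [hu.1]
    have h2 : (2 * u - a - b) / (b - a) ≠ 1 := by
      rw [Ne, div_eq_iff hc.ne']; intro h; linarith [hu.2]
    have hd : HasDerivAt (fun u : ℝ => (2 * u - a - b) / (b - a)) (2 / (b - a)) u := by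
      have := ((((hasDerivAt_id u).const_mul 2).sub_const a).sub_const b).div_const (b - a)
      simpa using this
    have h3 := (Real.hasDerivAt_arcsin h1 h2).comp u hd
    convert! h3 using 1
    have h4 : 1 - ((2 * u - a - b) / (b - a)) ^ 2 = (u - a) * (b - u) * (2 / (b - a)) ^ 2 := by
      field_simp; ring
    have h5 : 0 < 2 / (b - a) := by positivity
    have h6 : 0 < Real.sqrt ((u - a) * (b - u)) :=
      Real.sqrt_pos.mpr (mul_pos (by linarith [hu.1]) (by linarith [hu.2]))
    rw [h4, Real.sqrt_mul' _ (sq_nonneg _), Real.sqrt_sq h5.le]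
    field_simp
  · intro u _
    positivity

theorem integral_pos_aux {a b : ℝ} (hab : a < b) {g f : ℝ → ℝ} (hg : ContinuousOn g (Icc a b))
    (hpos : ∀ u ∈ Icc a b, 0 < g u)
    (hf : ∀ u ∈ Icc a b, f u = (u - a) * (b - u) * g u) :
    0 < ∫ u in a..b, 1 / Real.sqrt (f u) := by
  have hs : ContinuousOn (fun u => 1 / Real.sqrt (g u)) (uIcc a b) := by
    rw [uIcc_of_le hab.le]
    exact continuousOn_const.div (Real.continuous_sqrt.comp_continuousOn hg)
      fun u hu => (Real.sqrt_pos.mpr (hpos u hu)).ne'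
  have hi := (intervalIntegrable_arcsine hab).mul_continuousOn hs
  refine intervalIntegral.intervalIntegral_pos_of_pos_on (hi.congr fun u hu => ?_) ?_ hab
  · have hu' : u ∈ Icc a b := by
      rw [uIoc_of_le hab.le] at hu; exact Ioc_subset_Icc_self hu
    have h0 : 0 ≤ (u - a) * (b - u) := mul_nonneg (by linarith [hu'.1]) (by linarith [hu'.2])
    simp only [hf u hu', Real.sqrt_mul h0, one_div, mul_inv]
  · intro u hu
    have hu' := Ioo_subset_Icc_self hu
    rw [hf u hu']
    have : 0 < (u - a) * (b - u) * g u :=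
      mul_pos (mul_pos (by linarith [hu.1]) (by linarith [hu.2])) (hpos u hu')
    positivity

theorem imagHalfPeriod_pos {e₁ e₄ : ℝ} (h₁ : -e₄ < e₁) (h₂ : e₁ < e₄) :
    0 < imagHalfPeriod e₁ e₄ :=
  integral_pos_aux h₂ (g := fun u => 4 * (u + e₄)) (by fun_prop)
    (fun u hu => by linarith [hu.1]) (fun u _ => by unfold cubic; ring)

theorem realHalfPeriod_pos {e₁ e₄ : ℝ} (h₁ : -e₄ < e₁) (h₂ : e₁ < e₄) :
    0 < realHalfPeriod e₁ e₄ :=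
  integral_pos_aux h₁ (g := fun u => 4 * (e₄ - u)) (by fun_prop)
    (fun u hu => by linarith [hu.2]) (fun u _ => by unfold cubic; ring)

/-- The period lattice of the curve `w² = R(u)`, generated by the two cycle integrals
of `du / w`. -/
noncomputable def periods (e₁ e₄ : ℝ) (h₁ : -e₄ < e₁) (h₂ : e₁ < e₄) : PeriodPair where
  ω₁ := 2 * (Complex.I * (imagHalfPeriod e₁ e₄ : ℂ))
  ω₂ := 2 * (realHalfPeriod e₁ e₄ : ℂ)
  indep := by
    rw [LinearIndependent.pair_iff]
    intro p q hpq
    have hi := imagHalfPeriod_pos h₁ h₂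
    have hr := realHalfPeriod_pos h₁ h₂
    have hre := congrArg Complex.re hpq
    have him := congrArg Complex.im hpq
    simp at hre him
    exact ⟨him.resolve_right hi.ne', hre.resolve_right hr.ne'⟩

/-- A continuously differentiable path `τ ↦ (u τ, w τ)`, `0 ≤ τ ≤ 1`, on the affine curve
`w² = R(u)`, starting at the branch point `(e₁, 0)`. -/
structure CurvePath (e₁ e₄ : ℝ) where
  u : ℝ → ℂ
  w : ℝ → ℂ
  contDiffOn_u : ContDiffOn ℝ 1 u (Icc 0 1)
  contDiffOn_w : ContDiffOn ℝ 1 w (Icc 0 1)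
  mem_curve : ∀ τ ∈ Icc (0 : ℝ) 1, w τ ^ 2 = cubic (e₁ : ℂ) (e₄ : ℂ) (u τ)
  u_zero : u 0 = (e₁ : ℂ)

namespace CurvePath

variable {e₁ e₄ : ℝ}

/-- The pullback of the differential `f(u) du / w` to the parameter interval. At almost every
parameter where `w = 0` also `dw = 0`, hence `du / w = 2 dw / R'(u) = 0` there, which is the
value of the quotient below; so this is the correct density of the pullback. -/
noncomputable def density (γ : CurvePath e₁ e₄) (f : ℂ → ℂ) (τ : ℝ) : ℂ :=
  f (γ.u τ) * (derivWithin γ.u (Icc 0 1) τ / γ.w τ)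

/-- The Abelian integral of `f(u) du / w` along the part of the path up to the parameter `T`. -/
noncomputable def abelianIntegral (γ : CurvePath e₁ e₄) (f : ℂ → ℂ) (T : ℝ) : ℂ :=
  ∫ τ in (0 : ℝ)..T, γ.density f τ

/-- The uniformizing variable `x = ∫ du / w`, the integral starting at `(e₁, 0)`. -/
noncomputable def x (γ : CurvePath e₁ e₄) (T : ℝ) : ℂ :=
  γ.abelianIntegral (fun _ => 1) T

/-- Time, `t = i √(2s) ∫ (u² - e₄²) / (u - 1) du / w`, with `t = 0` at the start `x = 0`. -/
noncomputable def time (γ : CurvePath e₁ e₄) (s T : ℝ) : ℂ :=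
  Complex.I * (Real.sqrt (2 * s) : ℂ) *
    γ.abelianIntegral (fun u => (u ^ 2 - (e₄ : ℂ) ^ 2) / (u - 1)) T

end CurvePath

end AperiodicTop

/-! The curve is uniformized by `u = ℘(x - ω₃) + e₁/3`, `w = ℘'(x - ω₃)`, where `℘(ω₃) = 2e₁/3`
makes `x = 0` the branch point `(e₁, 0)`. Write `(u² - e₄²)/(u - 1) = u + 1 + (1 - e₄²)/(u - 1)`.
The part `u + 1` integrates to `-ζ(x - ω₃) + (1 + e₁/3)x` up to a constant. For the rest put `z = x
- ω₃` and `v = b - ω₃`, so that `w₊/(u - 1) = ℘'(v)/(℘(z) - ℘(v)) = ζ(z - v) - ζ(z + v) + 2ζ(v)`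
(`derivWeierstrassP_div_eq`). Shifting `z + v` by the period `2ω₃` turns this into `ζ(x - b) - ζ(x +
b)` plus a constant, and integration gives the logarithm of a sigma quotient.

The identity between `ζ` and `℘` is the logarithmic derivative of the sigma factorization of `℘(z) -
℘(a)`, which is proved by Liouville's theorem (`sigmaRelation_eq_zero`).

It remains to show that the lattice defined by the real integrals belongs to this curve. The values
of `℘` at the half periods of a rectangular lattice are real roots `a < b < c` whose period
integrals are the half sides of the rectangle (`rect_roots`). These integrals determine the gaps
between the roots (`normalizedPeriod_injective`), and the roots sum to zero, so they are the shifted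
branch points (`periods_uniformize`).

Finally, `(u, w)` and its expression through `℘` solve the same differential equation with the same
initial value. They therefore agree along every path (`mem_uniformizedSet`), including paths through
branch points. -/

namespace PeriodPair

/-! ### Weierstrass zeta and sigma functions: convergence, derivatives, quasi-periodicity. -/

open Filter Topology

variable (L : PeriodPair)

/-- The three terms combine to `s²/(l²(s - l))`, which is of order `‖l‖⁻³` and hence summable over a
lattice of rank two. -/
theorem norm_zetaSummand_le {r : ℝ} (hr : 0 < r) {s l : ℂ} (hs : ‖s‖ < r) (h : 2 * r ≤ ‖l‖) :
    ‖1 / (s - l) + 1 / l + s / l ^ 2‖ ≤ 2 * r ^ 2 * ‖l‖ ^ (-3 : ℝ) := by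
  have hl : 0 < ‖l‖ := by linarith
  have hl0 : l ≠ 0 := norm_pos_iff.mp hl
  have hsl : s - l ≠ 0 := by
    rw [sub_ne_zero]; rintro rfl; linarith
  have e : 1 / (s - l) + 1 / l + s / l ^ 2 = s ^ 2 / (l ^ 2 * (s - l)) := by
    field_simp; ring
  have h1 : ‖l‖ / 2 ≤ ‖s - l‖ := by
    rw [norm_sub_rev]; exact le_trans (by linarith) (norm_sub_norm_le l s)
  have e2 : ‖l‖ ^ (-3 : ℝ) = (‖l‖ ^ 3)⁻¹ := by
    rw [Real.rpow_neg hl.le]; norm_cast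
  rw [e, e2, norm_div, norm_mul, norm_pow, norm_pow]
  calc ‖s‖ ^ 2 / (‖l‖ ^ 2 * ‖s - l‖) ≤ r ^ 2 / (‖l‖ ^ 2 * (‖l‖ / 2)) := by gcongr
    _ = 2 * r ^ 2 * (‖l‖ ^ 3)⁻¹ := by field_simp

theorem hasSumLocallyUniformly_weierstrassZeta :
    HasSumLocallyUniformly (fun (l : L.lattice) (z : ℂ) ↦ 1 / (z - l) + 1 / (l : ℂ) + z / (l : ℂ) ^ 2)
      L.weierstrassZeta := by
  refine L.hasSumLocallyUniformly_aux (u := fun r l ↦ 2 * r ^ 2 * ‖l‖ ^ (-3 : ℝ)) _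
    (fun _ _ ↦ (ZLattice.summable_norm_rpow _ _ (by simp; norm_num)).mul_left _) fun r hr ↦
    Filter.eventually_atTop.mpr ⟨2 * r, ?_⟩
  rintro _ h s hs l rfl
  exact norm_zetaSummand_le hr hs h

theorem hasSum_weierstrassZeta (z : ℂ) :
    HasSum (fun l : L.lattice ↦ 1 / (z - l) + 1 / (l : ℂ) + z / (l : ℂ) ^ 2)
      (L.weierstrassZeta z) :=
  L.hasSumLocallyUniformly_weierstrassZeta.hasSum

theorem sub_ne_zero_of_notMem_lattice {z : ℂ} (hz : z ∉ L.lattice) (l : L.lattice) :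
    z - l ≠ 0 := by
  rw [sub_ne_zero]; rintro rfl; exact hz l.2

theorem hasDerivAt_zetaSummand {z l : ℂ} (h : z - l ≠ 0) :
    HasDerivAt (fun z ↦ 1 / (z - l) + 1 / l + z / l ^ 2) (-(1 / (z - l) ^ 2 - 1 / l ^ 2)) z := by
  have h1 := ((hasDerivAt_id z).sub_const l).inv h
  have h2 := (h1.add_const (1 / l)).add ((hasDerivAt_id z).div_const (l ^ 2))
  refine (h2.congr_deriv ?_).congr_of_eventuallyEq (.of_forall fun y ↦ ?_)
  · simp only [id]; ring
  · simp

theorem isOpen_compl_lattice : IsOpen ((L.lattice : Set ℂ)ᶜ) := L.isClosed_lattice.isOpen_compl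

theorem hasDerivAt_weierstrassZeta {z : ℂ} (hz : z ∉ L.lattice) :
    HasDerivAt L.weierstrassZeta (-L.weierstrassP z) z := by
  have hd : DifferentiableOn ℂ L.weierstrassZeta (L.lattice : Set ℂ)ᶜ := by
    refine L.hasSumLocallyUniformly_weierstrassZeta.hasSumLocallyUniformlyOn.differentiableOn
      (.of_forall fun s ↦ .fun_sum fun i hi x hx ↦ ?_) L.isOpen_compl_lattice
    exact (hasDerivAt_zetaSummand
      (L.sub_ne_zero_of_notMem_lattice hx i)).differentiableAt.differentiableWithinAt
  have he : Set.EqOn (deriv L.weierstrassZeta) (fun z ↦ -L.weierstrassP z)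
      (L.lattice : Set ℂ)ᶜ := by
    refine (L.hasSumLocallyUniformly_weierstrassZeta.tendstoLocallyUniformlyOn.deriv
      (.of_forall fun s ↦ .fun_sum fun i hi x hx ↦ ?_) L.isOpen_compl_lattice).unique ?_
    · exact (hasDerivAt_zetaSummand
        (L.sub_ne_zero_of_notMem_lattice hx i)).differentiableAt.differentiableWithinAt
    · refine (L.hasSumLocallyUniformly_weierstrassP.tendstoLocallyUniformlyOn.neg).congr ?_
      intro s x hx
      simp only [Function.comp_apply, Pi.neg_apply]
      rw [← Finset.sum_neg_distrib]
      refine ((HasDerivAt.fun_sum fun i _ ↦ hasDerivAt_zetaSummand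
        (L.sub_ne_zero_of_notMem_lattice hx i)).deriv).symm
  have := (hd z hz).differentiableAt (L.isOpen_compl_lattice.mem_nhds hz)
  exact this.hasDerivAt.congr_deriv (he hz)

theorem weierstrassZeta_neg (z : ℂ) : L.weierstrassZeta (-z) = -L.weierstrassZeta z := by
  simp only [weierstrassZeta]
  rw [← (Equiv.neg L.lattice).tsum_eq, ← tsum_neg]
  congr 1
  ext l
  simp only [Equiv.neg_apply, NegMemClass.coe_neg]
  rw [show -z - -(l : ℂ) = -(z - l) by ring]
  simp only [one_div, inv_neg, neg_sq]
  ring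

/-- The product of the Weierstrass elementary factors, so that `σ(z) = z * sigmaProd z`. -/
noncomputable def sigmaProd (z : ℂ) : ℂ := ∏' l : L.lattice,
    ((1 - z / (l : ℂ)) * Complex.exp (z / (l : ℂ) + z ^ 2 / (2 * (l : ℂ) ^ 2)))

theorem weierstrassSigma_eq (z : ℂ) : L.weierstrassSigma z = z * L.sigmaProd z := rfl

/-- The derivative of the elementary factor is `-x² exp(x + x²/2)`, because the exponent cancels the
lower-order terms. The mean value inequality on the disc of radius `‖w‖` then gives the cubic bound.
-/
theorem norm_elementaryFactor_sub_one_le {w : ℂ} (hw : ‖w‖ ≤ 1) :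
    ‖(1 - w) * Complex.exp (w + w ^ 2 / 2) - 1‖ ≤ Real.exp (3 / 2) * ‖w‖ ^ 3 := by
  have hd : ∀ x : ℂ, HasDerivAt (fun w : ℂ ↦ (1 - w) * Complex.exp (w + w ^ 2 / 2))
      (-x ^ 2 * Complex.exp (x + x ^ 2 / 2)) x := fun x ↦ by
    have h1 : HasDerivAt (fun w : ℂ ↦ w + w ^ 2 / 2) (1 + x) x := by
      have := (hasDerivAt_id x).add (((hasDerivAt_id x).pow 2).div_const 2)
      refine this.congr_deriv ?_
      simp
    refine ((((hasDerivAt_id x).const_sub 1).mul h1.cexp).congr_deriv ?_)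
    simp only [id]; ring
  have hb := Convex.norm_image_sub_le_of_norm_hasDerivWithin_le (C := ‖w‖ ^ 2 * Real.exp (3 / 2))
    (fun x _ ↦ (hd x).hasDerivWithinAt) (s := Metric.closedBall 0 ‖w‖) (fun x hx ↦ ?_)
    (convex_closedBall _ _) (x := 0) (y := w) (by simp) (by simp)
  · simp only [sub_zero, zero_div, add_zero, Complex.exp_zero, mul_one, ne_eq,
      OfNat.ofNat_ne_zero, not_false_eq_true, zero_pow] at hb
    calc _ ≤ _ := hb
      _ = _ := by ring
  · have hx' : ‖x‖ ≤ ‖w‖ := by simpa using hx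
    have hx1 : ‖x‖ ≤ 1 := hx'.trans hw
    rw [norm_mul, norm_neg, norm_pow, Complex.norm_exp]
    gcongr
    refine (Complex.re_le_norm _).trans ((norm_add_le _ _).trans ?_)
    rw [norm_div, norm_pow, Complex.norm_ofNat]
    nlinarith [norm_nonneg x]

theorem norm_sigmaFactor_sub_one_le {r : ℝ} {z l : ℂ} (hz : ‖z‖ < r) (hl : r ≤ ‖l‖) :
    ‖(1 - z / l) * Complex.exp (z / l + z ^ 2 / (2 * l ^ 2)) - 1‖ ≤
      Real.exp (3 / 2) * r ^ 3 * ‖l‖ ^ (-3 : ℝ) := by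
  have hl0 : 0 < ‖l‖ := ((norm_nonneg z).trans_lt hz).trans_le hl
  have e2 : ‖l‖ ^ (-3 : ℝ) = (‖l‖ ^ 3)⁻¹ := by
    rw [Real.rpow_neg hl0.le]; norm_cast
  have hw : ‖z / l‖ ≤ 1 := by rw [norm_div, div_le_one hl0]; exact hz.le.trans hl
  have := norm_elementaryFactor_sub_one_le hw
  rw [show (z / l) ^ 2 / 2 = z ^ 2 / (2 * l ^ 2) by rw [div_pow]; field_simp] at this
  refine this.trans ?_
  rw [e2, norm_div, div_pow, mul_assoc, ← div_eq_mul_inv (r ^ 3)]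
  gcongr

theorem eventually_norm_sigmaFactor_le (r : ℝ) :
    ∀ᶠ l : L.lattice in cofinite, ∀ z ∈ Metric.ball (0 : ℂ) r,
      ‖(1 - z / (l : ℂ)) * Complex.exp (z / (l : ℂ) + z ^ 2 / (2 * (l : ℂ) ^ 2)) - 1‖ ≤
      Real.exp (3 / 2) * r ^ 3 * ‖(l : L.lattice)‖ ^ (-3 : ℝ) := by
  refine (isCompact_iff_finite.mp (isCompact_closedBall (0 : L.lattice) r)).subset ?_
  intro l hl
  simp only [Metric.mem_closedBall, dist_zero_right]
  by_contra! h
  exact hl fun z hz ↦ norm_sigmaFactor_sub_one_le (by simpa using hz) h.le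

theorem summable_sigmaFactor_bound (r : ℝ) :
    Summable fun l : L.lattice ↦ Real.exp (3 / 2) * r ^ 3 * ‖(l : L.lattice)‖ ^ (-3 : ℝ) :=
  (ZLattice.summable_norm_rpow _ _ (by simp; norm_num)).mul_left _

theorem differentiable_sigmaFactor (l : ℂ) :
    Differentiable ℂ fun z : ℂ ↦ (1 - z / l) * Complex.exp (z / l + z ^ 2 / (2 * l ^ 2)) := by
  simp only [div_eq_mul_inv]
  fun_prop

theorem hasProdLocallyUniformlyOn_sigmaProd (r : ℝ) :
    HasProdLocallyUniformlyOn
      (fun (l : L.lattice) (z : ℂ) ↦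
        (1 - z / (l : ℂ)) * Complex.exp (z / (l : ℂ) + z ^ 2 / (2 * (l : ℂ) ^ 2)))
      L.sigmaProd (Metric.ball 0 r) := by
  have := (L.summable_sigmaFactor_bound r).hasProdLocallyUniformlyOn_one_add
    (f := fun (l : L.lattice) (z : ℂ) ↦
        (1 - z / (l : ℂ)) * Complex.exp (z / (l : ℂ) + z ^ 2 / (2 * (l : ℂ) ^ 2)) - 1)
    Metric.isOpen_ball (L.eventually_norm_sigmaFactor_le r)
    (fun i ↦ ((differentiable_sigmaFactor (i : ℂ)).sub_const 1).continuous.continuousOn)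
  simp only [add_sub_cancel] at this
  exact this

theorem differentiable_sigmaProd : Differentiable ℂ L.sigmaProd := by
  intro z
  have h := (L.hasProdLocallyUniformlyOn_sigmaProd (‖z‖ + 1)).differentiableOn
    (.of_forall fun s ↦ .fun_finsetProd fun i _ ↦ (differentiable_sigmaFactor _).differentiableOn)
    Metric.isOpen_ball
  exact (h z (by simp)).differentiableAt (Metric.isOpen_ball.mem_nhds (by simp))

theorem sigmaProd_zero : L.sigmaProd 0 = 1 := by simp [sigmaProd]

theorem sigmaFactor_ne_zero {z : ℂ} {l : ℂ} (h : l = 0 ∨ z ≠ l) :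
    (1 - z / l) * Complex.exp (z / l + z ^ 2 / (2 * l ^ 2)) ≠ 0 := by
  refine mul_ne_zero ?_ (Complex.exp_ne_zero _)
  rcases eq_or_ne l 0 with rfl | hl
  · simp
  · rw [sub_ne_zero]
    intro he
    rw [eq_div_iff hl, one_mul] at he
    exact h.elim hl fun h ↦ h he.symm

theorem sigmaProd_ne_zero {z : ℂ} (hz : z ∉ L.lattice) : L.sigmaProd z ≠ 0 := by
  have h2 : Summable fun l : L.lattice ↦
      ‖(1 - z / (l : ℂ)) * Complex.exp (z / (l : ℂ) + z ^ 2 / (2 * (l : ℂ) ^ 2)) - 1‖ := by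
    refine (L.summable_sigmaFactor_bound (‖z‖ + 1)).of_norm_bounded_eventually ?_
    filter_upwards [L.eventually_norm_sigmaFactor_le (‖z‖ + 1)] with l hl
    simpa using hl z (by simp)
  have := tprod_one_add_ne_zero_of_summable (fun l : L.lattice ↦ ?_) h2
  · simp only [add_sub_cancel] at this
    exact this
  · simp only [add_sub_cancel]
    exact sigmaFactor_ne_zero (.inr fun h ↦ hz (h ▸ l.2))

theorem logDeriv_sigmaFactor {z : ℂ} (l : ℂ) (h : z ≠ l) :
    logDeriv (fun z : ℂ ↦ (1 - z / l) * Complex.exp (z / l + z ^ 2 / (2 * l ^ 2))) z =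
      if l = 0 then 0 else 1 / (z - l) + 1 / l + z / l ^ 2 := by
  rcases eq_or_ne l 0 with rfl | hl
  · simp [logDeriv]
  have hd : HasDerivAt (fun z : ℂ ↦ (1 - z / l) * Complex.exp (z / l + z ^ 2 / (2 * l ^ 2)))
      ((-(1 / l)) * Complex.exp (z / l + z ^ 2 / (2 * l ^ 2)) + (1 - z / l) *
        (Complex.exp (z / l + z ^ 2 / (2 * l ^ 2)) * (1 / l + 2 * z / (2 * l ^ 2)))) z := by
    have h1 := (hasDerivAt_id z).div_const l
    have h2 : HasDerivAt (fun z : ℂ ↦ z ^ 2 / (2 * l ^ 2)) (2 * z / (2 * l ^ 2)) z := by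
      simpa using ((hasDerivAt_id z).pow 2).div_const (2 * l ^ 2)
    exact (h1.const_sub 1).mul (h1.add h2).cexp
  have hE := Complex.exp_ne_zero (z / l + z ^ 2 / (2 * l ^ 2))
  have hzl : z - l ≠ 0 := sub_ne_zero.mpr h
  have hlz : l - z ≠ 0 := sub_ne_zero.mpr h.symm
  rw [logDeriv_apply, hd.deriv, if_neg hl]
  generalize Complex.exp (z / l + z ^ 2 / (2 * l ^ 2)) = E at *
  have : (1 - z / l) = (l - z) / l := by field_simp
  rw [this]
  field_simp
  ring

/-- The factor with `l = 0` is constant and contributes nothing, whereas the zeta summand with `l =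
0` is `1/z`; this accounts for the correction. -/
theorem logDeriv_sigmaProd {z : ℂ} (hz : z ∉ L.lattice) :
    logDeriv L.sigmaProd z = L.weierstrassZeta z - 1 / z := by
  have hs := L.hasSum_weierstrassZeta z
  have h0 : HasSum (fun l : L.lattice ↦ if l = 0 then 1 / z else 0) (1 / z) := hasSum_ite_eq _ _
  have h1 := hs.sub h0
  have h2 : (fun l : L.lattice ↦ logDeriv (fun z : ℂ ↦ (1 - z / (l : ℂ)) *
      Complex.exp (z / (l : ℂ) + z ^ 2 / (2 * (l : ℂ) ^ 2))) z) =
      fun l : L.lattice ↦ (1 / (z - l) + 1 / (l : ℂ) + z / (l : ℂ) ^ 2) -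
        if l = 0 then 1 / z else 0 := by
    ext l
    have hzl : z ≠ l := fun h ↦ hz (h ▸ l.2)
    rw [logDeriv_sigmaFactor _ hzl]
    by_cases hl : l = 0
    · simp [hl]
    · have : (l : ℂ) ≠ 0 := by simpa using hl
      simp [hl]
  have := logDeriv_tprod_eq_tsum (x := z) (s := Metric.ball 0 (‖z‖ + 1))
    (f := fun (l : L.lattice) (z : ℂ) ↦
        (1 - z / (l : ℂ)) * Complex.exp (z / (l : ℂ) + z ^ 2 / (2 * (l : ℂ) ^ 2)))
    Metric.isOpen_ball (by simp)
    (fun l ↦ sigmaFactor_ne_zero (.inr fun h ↦ hz (h ▸ l.2)))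
    (fun l ↦ (differentiable_sigmaFactor _).differentiableOn) (h2 ▸ h1.summable)
    (L.hasProdLocallyUniformlyOn_sigmaProd _).multipliableLocallyUniformlyOn
    (L.sigmaProd_ne_zero hz)
  rw [h2, h1.tsum_eq] at this
  exact this

theorem differentiable_weierstrassSigma : Differentiable ℂ L.weierstrassSigma :=
  differentiable_id.mul L.differentiable_sigmaProd

theorem ne_zero_of_notMem_lattice {z : ℂ} (hz : z ∉ L.lattice) : z ≠ 0 := by
  rintro rfl; exact hz L.lattice.zero_mem

theorem weierstrassSigma_ne_zero {z : ℂ} (hz : z ∉ L.lattice) : L.weierstrassSigma z ≠ 0 :=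
  mul_ne_zero (L.ne_zero_of_notMem_lattice hz) (L.sigmaProd_ne_zero hz)

theorem weierstrassSigma_eq_zero {z : ℂ} (hz : z ∈ L.lattice) : L.weierstrassSigma z = 0 := by
  rcases eq_or_ne z 0 with rfl | h0
  · simp [weierstrassSigma_eq]
  have : L.sigmaProd z = 0 := by
    refine tprod_of_exists_eq_zero ⟨⟨z, hz⟩, ?_⟩
    simp [div_self h0]
  simp [weierstrassSigma_eq, this]

theorem hasDerivAt_weierstrassSigma {z : ℂ} (hz : z ∉ L.lattice) :
    HasDerivAt L.weierstrassSigma (L.weierstrassZeta z * L.weierstrassSigma z) z := by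
  have h := L.logDeriv_sigmaProd hz
  have hp := L.sigmaProd_ne_zero hz
  have h0 := L.ne_zero_of_notMem_lattice hz
  rw [logDeriv_apply, div_eq_iff hp] at h
  have hd := (hasDerivAt_id z).mul (L.differentiable_sigmaProd z).hasDerivAt
  refine hd.congr_deriv ?_
  rw [h, weierstrassSigma_eq]
  simp only [id]
  field_simp
  ring

theorem sigmaProd_neg (z : ℂ) : L.sigmaProd (-z) = L.sigmaProd z := by
  simp only [sigmaProd]
  rw [← (Equiv.neg L.lattice).tprod_eq]
  simp

theorem weierstrassSigma_neg (z : ℂ) : L.weierstrassSigma (-z) = -L.weierstrassSigma z := by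
  rw [weierstrassSigma_eq, weierstrassSigma_eq, sigmaProd_neg, neg_mul]

theorem countable_lattice : (L.lattice : Set ℂ).Countable :=
  (Set.countable_coe_iff (s := (L.lattice : Set ℂ))).mp
    (inferInstanceAs (Countable L.lattice))

theorem isPreconnected_compl_lattice : IsPreconnected ((L.lattice : Set ℂ)ᶜ) :=
  (L.countable_lattice.isConnected_compl_of_one_lt_rank
    (by rw [Complex.rank_real_complex]; norm_num)).isPreconnected

theorem add_mem_lattice_iff {z l : ℂ} (hl : l ∈ L.lattice) : z + l ∈ L.lattice ↔ z ∈ L.lattice :=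
  Submodule.add_mem_iff_left _ hl

/-- The difference has derivative zero because `℘` is periodic. It is a single constant because the
complement of the countable lattice is connected. -/
theorem exists_weierstrassZeta_add {l : ℂ} (hl : l ∈ L.lattice) :
    ∃ η : ℂ, ∀ z ∉ L.lattice, L.weierstrassZeta (z + l) = L.weierstrassZeta z + η := by
  have hd : ∀ z ∈ (L.lattice : Set ℂ)ᶜ,
      HasDerivAt (fun z ↦ L.weierstrassZeta (z + l) - L.weierstrassZeta z) 0 z := fun z hz ↦ by
    have h1 := (L.hasDerivAt_weierstrassZeta
      (z := z + l) (by rwa [L.add_mem_lattice_iff hl])).comp_add_const z l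
    refine (h1.sub (L.hasDerivAt_weierstrassZeta hz)).congr_deriv ?_
    rw [L.weierstrassP_add_coe z ⟨l, hl⟩]; ring
  obtain ⟨η, hη⟩ := L.isOpen_compl_lattice.exists_is_const_of_deriv_eq_zero
    L.isPreconnected_compl_lattice
    (fun z hz ↦ (hd z hz).differentiableAt.differentiableWithinAt) fun z hz ↦ (hd z hz).deriv
  exact ⟨η, fun z hz ↦ by linear_combination hη z hz⟩

theorem exists_weierstrassSigma_add {l : ℂ} (hl : l ∈ L.lattice) :
    ∃ c η : ℂ, ∀ z, L.weierstrassSigma (z + l) = c * Complex.exp (η * z) * L.weierstrassSigma z := by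
  obtain ⟨η, hη⟩ := L.exists_weierstrassZeta_add hl
  have hd : ∀ z ∈ (L.lattice : Set ℂ)ᶜ,
      HasDerivAt (fun z ↦ L.weierstrassSigma (z + l) / L.weierstrassSigma z *
        Complex.exp (-(η * z))) 0 z := fun z hz ↦ by
    have h1 := (L.hasDerivAt_weierstrassSigma
      (z := z + l) (by rwa [L.add_mem_lattice_iff hl])).comp_add_const z l
    have h2 := h1.div (L.hasDerivAt_weierstrassSigma hz) (L.weierstrassSigma_ne_zero hz)
    have h3 := h2.mul ((hasDerivAt_id z).const_mul η).neg.cexp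
    refine h3.congr_deriv ?_
    have := L.weierstrassSigma_ne_zero hz
    rw [hη z hz]
    simp only [id, Pi.div_apply]
    field_simp
    ring
  obtain ⟨c, hc⟩ := L.isOpen_compl_lattice.exists_is_const_of_deriv_eq_zero
    L.isPreconnected_compl_lattice
    (fun z hz ↦ (hd z hz).differentiableAt.differentiableWithinAt) fun z hz ↦ (hd z hz).deriv
  refine ⟨c, η, fun z ↦ ?_⟩
  by_cases hz : z ∈ L.lattice
  · rw [L.weierstrassSigma_eq_zero hz, L.weierstrassSigma_eq_zero, mul_zero]
    rwa [L.add_mem_lattice_iff hl]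
  · have := L.weierstrassSigma_ne_zero hz
    rw [← hc z hz, Complex.exp_neg]
    have := Complex.exp_ne_zero (η * z)
    field_simp

/-- The quasi-period is found by evaluating at `z = -ω` and using that `ζ` is odd. -/
theorem weierstrassZeta_add_two_mul {ω : ℂ} (hω : ω ∉ L.lattice) (h2 : 2 * ω ∈ L.lattice) {z : ℂ}
    (hz : z ∉ L.lattice) :
    L.weierstrassZeta (z + 2 * ω) = L.weierstrassZeta z + 2 * L.weierstrassZeta ω := by
  obtain ⟨η, hη⟩ := L.exists_weierstrassZeta_add h2
  have h := hη (-ω) (by simpa using hω)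
  rw [L.weierstrassZeta_neg, show -ω + 2 * ω = ω by ring] at h
  rw [hη z hz]
  linear_combination -h

end PeriodPair

/-! ### The sigma factorization of `℘(z) - ℘(a)` and its consequences. -/

theorem AnalyticAt.dslope_same {h : ℂ → ℂ} {z : ℂ} (hh : AnalyticAt ℂ h z) :
    AnalyticAt ℂ (dslope h z) z := by
  obtain ⟨p, hp⟩ := hh
  exact ⟨_, hp.has_fpower_series_dslope_fslope⟩

/-- An even analytic function that vanishes at the origin is divisible by `z²`. -/
theorem AnalyticAt.exists_eq_sq_mul_of_even {h : ℂ → ℂ} (hh : AnalyticAt ℂ h 0)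
    (heven : ∀ z, h (-z) = h z) (h0 : h 0 = 0) :
    ∃ k : ℂ → ℂ, AnalyticAt ℂ k 0 ∧ ∀ z, h z = z ^ 2 * k z := by
  refine ⟨dslope (dslope h 0) 0, hh.dslope_same.dslope_same, fun z ↦ ?_⟩
  have hd : deriv h 0 = 0 := by
    have := deriv_comp_neg h 0
    simp only [heven, neg_zero] at this
    linear_combination this / 2
  have h1 := sub_smul_dslope h 0 z
  have h2 := sub_smul_dslope (dslope h 0) 0 z
  rw [_root_.dslope_same, hd] at h2
  simp only [smul_eq_mul, sub_zero, h0] at h1 h2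
  rw [← h1, ← h2]; ring

namespace PeriodPair

open Filter Topology

variable (L : PeriodPair)

/-- The difference of the two sides of the sigma factorization of `℘(z) - ℘(a)`. -/
noncomputable def sigmaRelation (a z : ℂ) : ℂ :=
  L.weierstrassSigma (z - a) * L.weierstrassSigma (z + a) / L.weierstrassSigma z ^ 2 +
    L.weierstrassSigma a ^ 2 * (L.weierstrassP z - L.weierstrassP a)

theorem sigmaRelation_self (a : ℂ) : L.sigmaRelation a a = 0 := by
  have : L.weierstrassSigma 0 = 0 := L.weierstrassSigma_eq_zero (zero_mem _)
  simp [sigmaRelation, this]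

/-- The multipliers at `z - a` and `z + a` have product `c² exp(2ηz)`, which is also the multiplier
of `σ(z)²`. -/
theorem sigmaRelation_add {a l : ℂ} (hl : l ∈ L.lattice) {z : ℂ} (hz : z ∉ L.lattice) :
    L.sigmaRelation a (z + l) = L.sigmaRelation a z := by
  obtain ⟨c, η, h⟩ := L.exists_weierstrassSigma_add hl
  have hs := L.weierstrassSigma_ne_zero hz
  have hs' : L.weierstrassSigma (z + l) ≠ 0 :=
    L.weierstrassSigma_ne_zero (by rwa [L.add_mem_lattice_iff hl])
  have hc : c ≠ 0 := by rintro rfl; simp [h z] at hs'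
  have hE := Complex.exp_ne_zero (η * z)
  simp only [sigmaRelation]
  rw [show z + l - a = z - a + l by ring, show z + l + a = z + a + l by ring, h, h, h,
    L.weierstrassP_add_coe z ⟨l, hl⟩, mul_sub, mul_add, Complex.exp_sub, Complex.exp_add]
  have hE' := Complex.exp_ne_zero (η * a)
  field_simp

theorem analyticAt_sigmaRelation (a : ℂ) {z : ℂ} (hz : z ∉ L.lattice) :
    AnalyticAt ℂ (L.sigmaRelation a) z := by
  have h1 := L.analyticOnNhd_weierstrassP z hz
  have h2 : AnalyticAt ℂ L.weierstrassSigma z := L.differentiable_weierstrassSigma.analyticAt z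
  have h3 : AnalyticAt ℂ (fun z ↦ L.weierstrassSigma (z - a)) z :=
    (L.differentiable_weierstrassSigma.comp (differentiable_id.sub_const a)).analyticAt z
  have h4 : AnalyticAt ℂ (fun z ↦ L.weierstrassSigma (z + a)) z :=
    (L.differentiable_weierstrassSigma.comp (differentiable_id.add_const a)).analyticAt z
  exact ((h3.mul h4).div (h2.pow 2) (pow_ne_zero 2 (L.weierstrassSigma_ne_zero hz))).add
    (analyticAt_const.mul (h1.sub analyticAt_const))

/-- The singularity at the origin is removable: `z²` times the relation extends to an even analytic
function, and its value `-σ(a)² + σ(a)²` at the origin is zero, so it is divisible by `z²`. -/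
theorem exists_analyticAt_eq_sigmaRelation (a : ℂ) :
    ∃ k : ℂ → ℂ, AnalyticAt ℂ k 0 ∧ ∀ z ∉ L.lattice, L.sigmaRelation a z = k z := by
  set h : ℂ → ℂ := fun z ↦
    L.weierstrassSigma (z - a) * L.weierstrassSigma (z + a) / L.sigmaProd z ^ 2 +
      L.weierstrassSigma a ^ 2 * (1 + z ^ 2 * (L.weierstrassPExcept 0 z - L.weierstrassP a))
    with hh
  have han : AnalyticAt ℂ h 0 := by
    have h1 := L.analyticAt_weierstrassPExcept 0
    have h2 : AnalyticAt ℂ L.sigmaProd 0 := L.differentiable_sigmaProd.analyticAt 0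
    have h3 : AnalyticAt ℂ (fun z ↦ L.weierstrassSigma (z - a)) 0 :=
      (L.differentiable_weierstrassSigma.comp (differentiable_id.sub_const a)).analyticAt 0
    have h4 : AnalyticAt ℂ (fun z ↦ L.weierstrassSigma (z + a)) 0 :=
      (L.differentiable_weierstrassSigma.comp (differentiable_id.add_const a)).analyticAt 0
    exact ((h3.mul h4).div (h2.pow 2) (by simp [sigmaProd_zero])).add
      (analyticAt_const.mul (analyticAt_const.add ((analyticAt_id.pow 2).mul
        (h1.sub analyticAt_const))))
  have heven : ∀ z, h (-z) = h z := fun z ↦ by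
    simp only [hh, L.sigmaProd_neg, L.weierstrassPExcept_neg, neg_zero, neg_sq]
    rw [show -z - a = -(z + a) by ring, show -z + a = -(z - a) by ring]
    simp only [weierstrassSigma_neg]
    ring
  have h0 : h 0 = 0 := by
    simp [hh, sigmaProd_zero, weierstrassSigma_neg, ← sq]
  obtain ⟨k, hk, hk'⟩ := han.exists_eq_sq_mul_of_even heven h0
  refine ⟨k, hk, fun z hz ↦ ?_⟩
  have h0 := L.ne_zero_of_notMem_lattice hz
  have hz2 := hk' z
  have hP := L.weierstrassPExcept_add 0 z
  simp only [ZeroMemClass.coe_zero, sub_zero, ne_eq, OfNat.ofNat_ne_zero, not_false_eq_true,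
    zero_pow, div_zero] at hP
  refine mul_left_cancel₀ (pow_ne_zero 2 h0) (Eq.trans ?_ hz2)
  have := L.sigmaProd_ne_zero hz
  simp only [sigmaRelation, L.weierstrassSigma_eq z, ← hP, hh]
  field_simp
  ring

/-- After filling in the lattice points, the relation is entire and periodic, hence bounded and
constant. It vanishes at `z = a`. -/
theorem sigmaRelation_eq_zero {a z : ℂ} (ha : a ∉ L.lattice) (hz : z ∉ L.lattice) :
    L.sigmaRelation a z = 0 := by
  classical
  obtain ⟨k, hk, hk'⟩ := L.exists_analyticAt_eq_sigmaRelation a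
  set F : ℂ → ℂ := fun z ↦ if z ∈ L.lattice then k 0 else L.sigmaRelation a z with hF
  have hper : ∀ z w, w ∈ L.lattice → F (z + w) = F z := fun z w hw ↦ by
    simp only [hF, L.add_mem_lattice_iff hw]
    split_ifs with h
    · rfl
    · exact L.sigmaRelation_add hw h
  have h0 : AnalyticAt ℂ F 0 := by
    refine hk.congr ?_
    filter_upwards [L.compl_lattice_sdiff_singleton_mem_nhds 0] with z hz
    by_cases hz0 : z = 0
    · simp [hF, hz0]
    · have hz' : z ∉ L.lattice := by simp_all
      simp only [hF, if_neg hz', hk' z hz']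
  have hdiff : Differentiable ℂ F := fun x ↦ by
    refine AnalyticAt.differentiableAt ?_
    by_cases hx : x ∈ L.lattice
    · have h1 : AnalyticAt ℂ (fun y ↦ F (y - x)) x := by
        have h0' : AnalyticAt ℂ F (x - x) := by rwa [sub_self]
        exact h0'.comp (f := (· - x)) (by fun_prop)
      refine h1.congr (.of_forall fun y ↦ ?_)
      simpa [sub_eq_add_neg] using! hper y (-x) (neg_mem hx)
    · refine (L.analyticAt_sigmaRelation a hx).congr ?_
      filter_upwards [L.isOpen_compl_lattice.mem_nhds hx] with y hy
      exact (if_neg hy).symm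
  have := hdiff.apply_eq_apply_of_bounded (IsZLattice.isCompact_range_of_periodic L.lattice _
    hdiff.continuous hper).isBounded z a
  simpa [hF, ha, hz, sigmaRelation_self] using this

/-- `℘(z) - ℘(a) = -σ(z-a)σ(z+a)/(σ(z)²σ(a)²)`, without denominators. -/
theorem weierstrassP_sub_mul_sigma {a z : ℂ} (ha : a ∉ L.lattice) (hz : z ∉ L.lattice) :
    (L.weierstrassP z - L.weierstrassP a) * L.weierstrassSigma z ^ 2 * L.weierstrassSigma a ^ 2 =
      -(L.weierstrassSigma (z - a) * L.weierstrassSigma (z + a)) := by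
  have h := L.sigmaRelation_eq_zero ha hz
  have hs := L.weierstrassSigma_ne_zero hz
  simp only [sigmaRelation] at h
  field_simp at h
  linear_combination h

theorem mem_lattice_of_weierstrassP_eq {a z : ℂ} (ha : a ∉ L.lattice) (hz : z ∉ L.lattice)
    (h : L.weierstrassP z = L.weierstrassP a) : z - a ∈ L.lattice ∨ z + a ∈ L.lattice := by
  have h1 := L.weierstrassP_sub_mul_sigma ha hz
  rw [h, sub_self, zero_mul, zero_mul, zero_eq_neg, mul_eq_zero] at h1
  by_contra! h2
  exact h1.elim (L.weierstrassSigma_ne_zero h2.1) (L.weierstrassSigma_ne_zero h2.2)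

theorem hasDerivAt_weierstrassP {z : ℂ} (hz : z ∉ L.lattice) :
    HasDerivAt L.weierstrassP (L.derivWeierstrassP z) z := by
  rw [← L.deriv_weierstrassP]
  exact (L.analyticOnNhd_weierstrassP z hz).differentiableAt.hasDerivAt

theorem hasDerivAt_sub_sigma (z a : ℂ) (h1 : z - a ∉ L.lattice) (h2 : z + a ∉ L.lattice) :
    HasDerivAt (fun a ↦ -(L.weierstrassSigma (z - a) * L.weierstrassSigma (z + a)))
      ((L.weierstrassZeta (z - a) - L.weierstrassZeta (z + a)) *
        (L.weierstrassSigma (z - a) * L.weierstrassSigma (z + a))) a := by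
  have e1 := (L.hasDerivAt_weierstrassSigma h1).comp a ((hasDerivAt_id a).const_sub z)
  have e2 := (L.hasDerivAt_weierstrassSigma h2).comp a ((hasDerivAt_id a).const_add z)
  refine (e1.mul e2).neg.congr_deriv ?_
  simp only [Function.comp]
  ring

/-- This is the logarithmic derivative of the sigma factorization with respect to `a`, computed in
the form without denominators. -/
theorem derivWeierstrassP_div_eq {a z : ℂ} (ha : a ∉ L.lattice) (hz : z ∉ L.lattice)
    (h1 : z - a ∉ L.lattice) (h2 : z + a ∉ L.lattice) :
    L.derivWeierstrassP a / (L.weierstrassP z - L.weierstrassP a) =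
      L.weierstrassZeta (z - a) - L.weierstrassZeta (z + a) + 2 * L.weierstrassZeta a := by
  have hsz := L.weierstrassSigma_ne_zero hz
  have hsa := L.weierstrassSigma_ne_zero ha
  have hP : L.weierstrassP z - L.weierstrassP a ≠ 0 := fun h ↦
    (L.mem_lattice_of_weierstrassP_eq ha hz (sub_eq_zero.mp h)).elim h1 h2
  have d1 := (((L.hasDerivAt_weierstrassP ha).const_sub (L.weierstrassP z)).mul_const
    (L.weierstrassSigma z ^ 2)).mul ((L.hasDerivAt_weierstrassSigma ha).pow 2)
  have d2 := (L.hasDerivAt_sub_sigma z a h1 h2).congr_of_eventuallyEq (f₁ :=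
    (fun a ↦ (L.weierstrassP z - L.weierstrassP a) * L.weierstrassSigma z ^ 2) *
      L.weierstrassSigma ^ 2) (by
    filter_upwards [L.isOpen_compl_lattice.mem_nhds ha] with y hy
    exact L.weierstrassP_sub_mul_sigma hy hz)
  have e := d1.unique d2
  have e' := L.weierstrassP_sub_mul_sigma ha hz
  rw [div_eq_iff hP]
  have hne : L.weierstrassSigma z ^ 2 * L.weierstrassSigma a ^ 2 ≠ 0 := by positivity
  refine mul_right_cancel₀ hne ?_
  simp only [Nat.cast_ofNat, Nat.add_one_sub_one, pow_one, Pi.pow_apply] at e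
  linear_combination -e - (L.weierstrassZeta (z - a) - L.weierstrassZeta (z + a)) * e'

/-- Differentiating the sigma factorization in `z` at `z = a`, with `σ(0) = 0` and `σ'(0) = 1`,
gives `℘'(a) σ(a)⁴ = -σ(2a)`. The zeros of `σ` are lattice points. -/
theorem two_mul_mem_of_derivWeierstrassP_eq_zero {a : ℂ} (ha : a ∉ L.lattice)
    (h : L.derivWeierstrassP a = 0) : 2 * a ∈ L.lattice := by
  by_contra h2
  have hsa := L.weierstrassSigma_ne_zero ha
  have hs2 := L.weierstrassSigma_ne_zero h2
  have d1 := (((L.hasDerivAt_weierstrassP ha).sub_const (L.weierstrassP a)).mul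
    ((L.hasDerivAt_weierstrassSigma ha).pow 2)).mul_const (L.weierstrassSigma a ^ 2)
  have e1 : HasDerivAt (fun z ↦ L.weierstrassSigma (z - a)) 1 a := by
    have : HasDerivAt L.weierstrassSigma 1 (a - a) := by
      rw [sub_self]
      refine ((hasDerivAt_id (0 : ℂ)).mul
        (L.differentiable_sigmaProd 0).hasDerivAt).congr_deriv ?_
      simp [sigmaProd_zero]
    exact this.comp_sub_const a a
  have e2 : HasDerivAt (fun z ↦ L.weierstrassSigma (z + a)) _ a :=
    (L.differentiable_weierstrassSigma (a + a)).hasDerivAt.comp_add_const a a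
  have d2 := ((e1.mul e2).neg).congr_of_eventuallyEq (f₁ := fun y ↦
    ((fun z ↦ L.weierstrassP z - L.weierstrassP a) * L.weierstrassSigma ^ 2) y *
      L.weierstrassSigma a ^ 2) (by
    filter_upwards [L.isOpen_compl_lattice.mem_nhds ha] with y hy
    exact L.weierstrassP_sub_mul_sigma ha hy)
  have e := d1.unique d2
  rw [h] at e
  have h0 : L.weierstrassSigma 0 = 0 := L.weierstrassSigma_eq_zero (zero_mem _)
  simp [h0, ← two_mul] at e
  exact hs2 e

theorem derivWeierstrassP_eq_zero {a : ℂ} (h2 : 2 * a ∈ L.lattice) :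
    L.derivWeierstrassP a = 0 := by
  have h := L.derivWeierstrassP_sub_coe a ⟨2 * a, h2⟩
  rw [show a - ((⟨2 * a, h2⟩ : L.lattice) : ℂ) = -a by simp; ring, L.derivWeierstrassP_neg] at h
  linear_combination -h / 2

/-- Differentiating `℘'² = 4℘³ - g₂℘ - g₃` and cancelling `2℘'` works away from the half periods,
which are countable. Continuity covers those that are not lattice points. -/
theorem hasDerivAt_derivWeierstrassP {z : ℂ} (hz : z ∉ L.lattice) :
    HasDerivAt L.derivWeierstrassP (6 * L.weierstrassP z ^ 2 - L.g₂ / 2) z := by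
  have hd : ∀ z ∈ (L.lattice : Set ℂ)ᶜ,
      HasDerivAt L.derivWeierstrassP (deriv L.derivWeierstrassP z) z := fun z hz ↦
    (L.analyticOnNhd_derivWeierstrassP z hz).differentiableAt.hasDerivAt
  have hgen : ∀ z ∉ L.lattice, 2 * z ∉ L.lattice →
      deriv L.derivWeierstrassP z = 6 * L.weierstrassP z ^ 2 - L.g₂ / 2 := fun z hz h2 ↦ by
    have d1 := (hd z hz).pow 2
    have hP := L.hasDerivAt_weierstrassP hz
    have d2 := ((((hP.pow 3).const_mul 4).sub (hP.const_mul L.g₂)).sub_const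
      L.g₃).congr_of_eventuallyEq (f₁ := L.derivWeierstrassP ^ 2) (by
        filter_upwards [L.isOpen_compl_lattice.mem_nhds hz] with y hy
        exact L.derivWeierstrassP_sq y hy)
    have e := d1.unique d2
    have h0 : L.derivWeierstrassP z ≠ 0 := fun h ↦
      h2 (L.two_mul_mem_of_derivWeierstrassP_eq_zero hz h)
    refine mul_left_cancel₀ h0 ?_
    simp only [Nat.cast_ofNat, Nat.add_one_sub_one, pow_one] at e
    linear_combination e / 2
  have hdense : Dense (((fun z : ℂ ↦ 2 * z) ⁻¹' (L.lattice : Set ℂ))ᶜ) :=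
    (L.countable_lattice.preimage (mul_right_injective₀ two_ne_zero)).dense_compl ℝ
  have : deriv L.derivWeierstrassP z = 6 * L.weierstrassP z ^ 2 - L.g₂ / 2 := by
    have c1 : ContinuousAt (fun z ↦ deriv L.derivWeierstrassP z -
        (6 * L.weierstrassP z ^ 2 - L.g₂ / 2)) z :=
      (L.analyticOnNhd_derivWeierstrassP z hz).deriv.continuousAt.sub
        (((L.analyticOnNhd_weierstrassP z hz).continuousAt.pow 2).const_mul 6 |>.sub
          continuousAt_const)
    by_contra hne
    have hev := c1.eventually_ne (sub_ne_zero.mpr hne)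
    obtain ⟨y, hy, hy2⟩ := mem_closure_iff_nhds.mp (hdense z) _
      (inter_mem hev (L.isOpen_compl_lattice.mem_nhds hz))
    exact hy.1 (sub_eq_zero.mpr (hgen y hy.2 hy2))
  exact this ▸ hd z hz

theorem notMem_of_half {h : ℂ} (h0 : h ∉ L.lattice) (h2 : 2 * h ∈ L.lattice) {k : ℂ}
    (hk : k ∉ L.lattice) (hne : h - k ∉ L.lattice) : L.weierstrassP h ≠ L.weierstrassP k := by
  intro e
  rcases L.mem_lattice_of_weierstrassP_eq hk h0 e with h' | h'
  · exact hne h'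
  · refine hne ?_
    have := sub_mem h2 h'
    rwa [show 2 * h - (h + k) = h - k by ring] at this

/-- The values of `℘` at three incongruent half periods are the roots of the cubic. -/
theorem halfPeriod_relations {h₁ h₂ h₃ : ℂ} (n₁ : h₁ ∉ L.lattice) (n₂ : h₂ ∉ L.lattice)
    (n₃ : h₃ ∉ L.lattice) (t₁ : 2 * h₁ ∈ L.lattice) (t₂ : 2 * h₂ ∈ L.lattice)
    (t₃ : 2 * h₃ ∈ L.lattice) (d₁₂ : h₁ - h₂ ∉ L.lattice) (d₁₃ : h₁ - h₃ ∉ L.lattice)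
    (d₂₃ : h₂ - h₃ ∉ L.lattice) :
    L.weierstrassP h₁ + L.weierstrassP h₂ + L.weierstrassP h₃ = 0 ∧
      (∀ z ∉ L.lattice, L.derivWeierstrassP z ^ 2 = 4 * (L.weierstrassP z - L.weierstrassP h₁) *
        (L.weierstrassP z - L.weierstrassP h₂) * (L.weierstrassP z - L.weierstrassP h₃)) ∧
      L.g₂ = 4 * (L.weierstrassP h₁ ^ 2 + L.weierstrassP h₁ * L.weierstrassP h₂ +
        L.weierstrassP h₂ ^ 2) := by
  have r₁ := L.derivWeierstrassP_sq h₁ n₁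
  have r₂ := L.derivWeierstrassP_sq h₂ n₂
  have r₃ := L.derivWeierstrassP_sq h₃ n₃
  rw [L.derivWeierstrassP_eq_zero t₁] at r₁
  rw [L.derivWeierstrassP_eq_zero t₂] at r₂
  rw [L.derivWeierstrassP_eq_zero t₃] at r₃
  have p₁₂ := sub_ne_zero.mpr (L.notMem_of_half n₁ t₁ n₂ d₁₂)
  have p₁₃ := sub_ne_zero.mpr (L.notMem_of_half n₁ t₁ n₃ d₁₃)
  have p₂₃ := sub_ne_zero.mpr (L.notMem_of_half n₂ t₂ n₃ d₂₃)
  generalize L.weierstrassP h₁ = E₁ at *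
  generalize L.weierstrassP h₂ = E₂ at *
  generalize L.weierstrassP h₃ = E₃ at *
  have g12 : 4 * (E₁ ^ 2 + E₁ * E₂ + E₂ ^ 2) = L.g₂ := by
    refine mul_left_cancel₀ p₁₂ ?_
    linear_combination r₂ - r₁
  have g13 : 4 * (E₁ ^ 2 + E₁ * E₃ + E₃ ^ 2) = L.g₂ := by
    refine mul_left_cancel₀ p₁₃ ?_
    linear_combination r₃ - r₁
  have hs : E₁ + E₂ + E₃ = 0 := by
    refine mul_left_cancel₀ p₂₃ ?_
    linear_combination (g12 - g13) / 4
  refine ⟨hs, fun z hz ↦ ?_, g12.symm⟩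
  rw [L.derivWeierstrassP_sq z hz]
  have h3 : E₃ = -E₁ - E₂ := by linear_combination hs
  subst h3
  linear_combination (L.weierstrassP z - E₁) * g12 - r₁

end PeriodPair

/-! ### Real period integrals of cubics, and recovery of the roots from them. -/

namespace AperiodicTop

/-- The period integral of a cubic with distances `x` and `y` from the third root to the end
points of the interval of integration, in normalized form. -/
noncomputable def normalizedPeriod (x y : ℝ) : ℝ :=
  ∫ v in (0 : ℝ)..1, 1 / Real.sqrt ((v - 0) * (1 - v) * (4 * (x + (y - x) * v)))

theorem affine_pos {x y : ℝ} (hx : 0 < x) (hy : 0 < y) {v : ℝ} (hv : v ∈ Icc (0 : ℝ) 1) :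
    0 < x + (y - x) * v := by
  rcases hv.1.eq_or_lt with h | h
  · simpa [← h] using hx
  · nlinarith [hv.2, mul_pos hy h, mul_nonneg hx.le (sub_nonneg.mpr hv.2)]

theorem intervalIntegrable_normalizedPeriod {x y : ℝ} (hx : 0 < x) (hy : 0 < y) :
    IntervalIntegrable (fun v : ℝ => 1 / Real.sqrt ((v - 0) * (1 - v) * (4 * (x + (y - x) * v))))
      MeasureTheory.volume 0 1 := by
  have hs : ContinuousOn (fun v : ℝ => 1 / Real.sqrt (4 * (x + (y - x) * v))) (uIcc 0 1) := by
    rw [uIcc_of_le zero_le_one]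
    refine continuousOn_const.div (Continuous.continuousOn (by fun_prop)) fun v hv => ?_
    exact (Real.sqrt_pos.mpr (mul_pos four_pos (affine_pos hx hy hv))).ne'
  refine ((intervalIntegrable_arcsine zero_lt_one).mul_continuousOn hs).congr fun v hv => ?_
  rw [uIoc_of_le zero_le_one] at hv
  have h0 : 0 ≤ (v - 0) * (1 - v) := mul_nonneg (by linarith [hv.1]) (by linarith [hv.2])
  simp only [Real.sqrt_mul h0, one_div, mul_inv]

theorem normalizedPeriod_lt {x y x' y' : ℝ} (hx : 0 < x) (hy : 0 < y) (hxx : x ≤ x')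
    (hyy : y ≤ y') (hne : x < x' ∨ y < y') : normalizedPeriod x' y' < normalizedPeriod x y := by
  have hx' := hx.trans_le hxx
  have hy' := hy.trans_le hyy
  have h1 := intervalIntegrable_normalizedPeriod hx hy
  have h2 := intervalIntegrable_normalizedPeriod hx' hy'
  rw [← sub_pos, normalizedPeriod, normalizedPeriod, ← intervalIntegral.integral_sub h1 h2]
  refine intervalIntegral.intervalIntegral_pos_of_pos_on (h1.sub h2) (fun v hv => ?_) zero_lt_one
  have hv0 : 0 < v := hv.1
  have hv1 : 0 < 1 - v := by linarith [hv.2]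
  have hc := affine_pos hx hy (Ioo_subset_Icc_self hv)
  have hlt : x + (y - x) * v < x' + (y' - x') * v := by
    rcases hne with h | h
    · nlinarith [mul_pos (sub_pos.mpr h) hv1, mul_nonneg (sub_nonneg.mpr hyy) hv0.le]
    · nlinarith [mul_nonneg (sub_nonneg.mpr hxx) hv1.le, mul_pos (sub_pos.mpr h) hv0]
  rw [sub_pos, sub_zero]
  have hw : 0 < v * (1 - v) := mul_pos hv0 hv1
  refine one_div_lt_one_div_of_lt (Real.sqrt_pos.mpr (by positivity))
    (Real.sqrt_lt_sqrt (by positivity) ?_)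
  gcongr

/-- Here `p` and `q` are the gaps between consecutive roots. If one total `p + q` is larger, one of
its gaps is at least the matching gap of the other pair, so strict monotonicity separates one of the
two integrals. If the totals agree, the first integral determines `q`. -/
theorem normalizedPeriod_injective {p q p' q' : ℝ} (hp : 0 < p) (hq : 0 < q) (hp' : 0 < p')
    (hq' : 0 < q') (h1 : normalizedPeriod (p + q) q = normalizedPeriod (p' + q') q')
    (h2 : normalizedPeriod (p + q) p = normalizedPeriod (p' + q') p') : p = p' ∧ q = q' := by
  rcases lt_trichotomy (p + q) (p' + q') with h | h | h
  · exfalso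
    rcases le_or_gt q q' with hqq | hqq
    · exact (normalizedPeriod_lt (by positivity) hq h.le hqq (.inl h)).ne' h1
    · rcases le_or_gt p p' with hpp | hpp
      · exact (normalizedPeriod_lt (by positivity) hp h.le hpp (.inl h)).ne' h2
      · linarith
  · rcases lt_trichotomy q q' with hqq | hqq | hqq
    · exact ((normalizedPeriod_lt (by positivity) hq h.le hqq.le (.inr hqq)).ne' h1).elim
    · exact ⟨by linarith, hqq⟩
    · exact ((normalizedPeriod_lt (by positivity) hq' h.ge hqq.le (.inr hqq)).ne h1).elim
  · exfalso
    rcases le_or_gt q' q with hqq | hqq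
    · exact (normalizedPeriod_lt (by positivity) hq' h.le hqq (.inl h)).ne h1
    · rcases le_or_gt p' p with hpp | hpp
      · exact (normalizedPeriod_lt (by positivity) hp' h.le hpp (.inl h)).ne h2
      · linarith

/-- Under `u = a + (b - a)v` the factor `b - a` from `du` cancels the one from the square root, so
only distances to the third root remain. -/
theorem integral_cubic_eq_normalizedPeriod {a b c : ℝ} (hab : a < b) :
    ∫ u in a..b, 1 / Real.sqrt (4 * (u - a) * (u - b) * (u - c)) =
      normalizedPeriod (c - a) (c - b) := by
  have hp : 0 < b - a := sub_pos.mpr hab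
  have h := intervalIntegral.smul_integral_comp_mul_add
    (f := fun u : ℝ => 1 / Real.sqrt (4 * (u - a) * (u - b) * (u - c))) (a := 0) (b := 1) (b - a) a
  rw [mul_zero, zero_add, mul_one, sub_add_cancel] at h
  rw [← h, normalizedPeriod, smul_eq_mul, ← intervalIntegral.integral_const_mul]
  congr 1
  ext v
  have : 4 * ((b - a) * v + a - a) * ((b - a) * v + a - b) * ((b - a) * v + a - c) =
      (b - a) ^ 2 * ((v - 0) * (1 - v) * (4 * (c - a + (c - b - (c - a)) * v))) := by ring
  rw [this, Real.sqrt_mul (sq_nonneg _), Real.sqrt_sq hp.le]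
  field_simp

theorem realHalfPeriod_eq {e₁ e₄ : ℝ} (h₁ : -e₄ < e₁) :
    realHalfPeriod e₁ e₄ = normalizedPeriod (e₁ + e₄ + (e₄ - e₁)) (e₄ - e₁) := by
  have := integral_cubic_eq_normalizedPeriod (c := e₄) h₁
  rw [show e₁ + e₄ + (e₄ - e₁) = e₄ - -e₄ by ring, ← this, realHalfPeriod]
  congr! 4 with u
  simp only [cubic]; ring

/-- The reflection `u ↦ -u` turns `-R` into the cubic with roots `-e₄`, `-e₁`, `e₄`, so the
imaginary period has the same shape as the real one. -/
theorem imagHalfPeriod_eq {e₁ e₄ : ℝ} (h₂ : e₁ < e₄) :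
    imagHalfPeriod e₁ e₄ = normalizedPeriod (e₁ + e₄ + (e₄ - e₁)) (e₁ + e₄) := by
  have := integral_cubic_eq_normalizedPeriod (c := e₄) (neg_lt_neg h₂)
  rw [show e₁ + e₄ + (e₄ - e₁) = e₄ - -e₄ by ring, show e₁ + e₄ = e₄ - -e₁ by ring, ← this,
    imagHalfPeriod, ← intervalIntegral.integral_comp_neg]
  congr! 4 with u
  simp only [cubic]; ring

/-- A function on `[0, B]` that joins two roots of a cubic and inverts its period integral. -/
structure IsCubicArc (a b c B : ℝ) (f f' : ℝ → ℝ) : Prop where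
  pos : 0 < B
  continuousOn : ContinuousOn f (Icc 0 B)
  hasDerivAt : ∀ x ∈ Ioo 0 B, HasDerivAt f (f' x) x
  deriv_ne_zero : ∀ x ∈ Ioo 0 B, f' x ≠ 0
  sq_deriv : ∀ x ∈ Ioo 0 B, f' x ^ 2 = 4 * (f x - a) * (f x - b) * (f x - c)
  left : f 0 = a
  right : f B = b

namespace IsCubicArc

variable {a b c B : ℝ} {f f' : ℝ → ℝ}

theorem mono_or_anti (h : IsCubicArc a b c B f f') :
    ((∀ x ∈ Ioo 0 B, f' x < 0) ∧ StrictAntiOn f (Icc 0 B)) ∨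
      ((∀ x ∈ Ioo 0 B, 0 < f' x) ∧ StrictMonoOn f (Icc 0 B)) := by
  rcases hasDerivWithinAt_forall_lt_or_forall_gt_of_forall_ne (convex_Ioo 0 B)
    (fun x hx => (h.hasDerivAt x hx).hasDerivWithinAt) h.deriv_ne_zero with hn | hp
  · refine .inl ⟨hn, strictAntiOn_of_deriv_neg (convex_Icc 0 B) h.continuousOn fun x hx => ?_⟩
    rw [interior_Icc] at hx
    rw [(h.hasDerivAt x hx).deriv]; exact hn x hx
  · refine .inr ⟨hp, strictMonoOn_of_deriv_pos (convex_Icc 0 B) h.continuousOn fun x hx => ?_⟩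
    rw [interior_Icc] at hx
    rw [(h.hasDerivAt x hx).deriv]; exact hp x hx

/-- Inside the interval `f` lies strictly between `a` and `b`, so positivity of the squared
derivative forces `f` below `c`. The order of `a` and `b` is not needed, and applying this to two
arcs will order the three roots. -/
theorem right_le (h : IsCubicArc a b c B f f') : b ≤ c := by
  have hB := h.pos
  have hlt : ∀ x ∈ Ioo 0 B, f x ≤ c := fun x hx => by
    have hx' := Ioo_subset_Icc_self hx
    have hab : (f x - a) * (f x - b) < 0 := by
      rw [← h.left, ← h.right]
      rcases h.mono_or_anti with ⟨-, hm⟩ | ⟨-, hm⟩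
      · exact mul_neg_of_neg_of_pos (sub_neg.mpr (hm (left_mem_Icc.mpr hB.le) hx' hx.1))
          (sub_pos.mpr (hm hx' (right_mem_Icc.mpr hB.le) hx.2))
      · exact mul_neg_of_pos_of_neg (sub_pos.mpr (hm (left_mem_Icc.mpr hB.le) hx' hx.1))
          (sub_neg.mpr (hm hx' (right_mem_Icc.mpr hB.le) hx.2))
    have hs := h.sq_deriv x hx
    have hpos : 0 < f' x ^ 2 := by have := h.deriv_ne_zero x hx; positivity
    by_contra! hc
    nlinarith [mul_pos (neg_pos.mpr hab) (sub_pos.mpr hc)]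
  rw [← h.right]
  have hcl : closure (Ioo 0 B) = Icc 0 B := closure_Ioo hB.ne
  refine ContinuousWithinAt.closure_le (s := Ioo 0 B) (f := f) (g := fun _ => c) (x := B) ?_ ?_
    continuousWithinAt_const hlt
  · rw [hcl]; exact right_mem_Icc.mpr hB.le
  · exact (h.continuousOn B (right_mem_Icc.mpr hB.le)).mono Ioo_subset_Icc_self

/-- Substituting `u = f x` turns the period integrand into the constant `1`, since `f'` is the
square root of the cubic. -/
theorem normalizedPeriod_eq (h : IsCubicArc a b c B f f') (hab : a < b) :
    normalizedPeriod (c - a) (c - b) = B := by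
  have hB := h.pos
  rcases h.mono_or_anti with ⟨-, hm⟩ | ⟨hp, hm⟩
  · have := hm (left_mem_Icc.mpr hB.le) (right_mem_Icc.mpr hB.le) hB
    rw [h.left, h.right] at this
    linarith
  have himg : f '' Ioo 0 B = Ioo a b := by
    refine Subset.antisymm ?_ ?_
    · rintro _ ⟨x, hx, rfl⟩
      have hx' := Ioo_subset_Icc_self hx
      rw [← h.left, ← h.right]
      exact ⟨hm (left_mem_Icc.mpr hB.le) hx' hx.1, hm hx' (right_mem_Icc.mpr hB.le) hx.2⟩
    · have := intermediate_value_Ioo hB.le h.continuousOn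
      rwa [h.left, h.right] at this
  rw [← integral_cubic_eq_normalizedPeriod hab, intervalIntegral.integral_of_le hab.le,
    MeasureTheory.integral_Ioc_eq_integral_Ioo, ← himg,
    MeasureTheory.integral_image_eq_integral_abs_deriv_smul measurableSet_Ioo
      (fun x hx => (h.hasDerivAt x hx).hasDerivWithinAt)
      (hm.injOn.mono Ioo_subset_Icc_self)]
  have : ∀ x ∈ Ioo 0 B, |f' x| • (1 / Real.sqrt (4 * (f x - a) * (f x - b) * (f x - c))) = 1 :=
    fun x hx => by
      have := hp x hx
      rw [← h.sq_deriv x hx, Real.sqrt_sq this.le, abs_of_pos this, smul_eq_mul]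
      field_simp
  rw [MeasureTheory.setIntegral_congr_fun measurableSet_Ioo this]
  simp [hB.le]

end IsCubicArc

end AperiodicTop

/-! ### Rectangular lattices: `℘` along two sides of the half-period rectangle. -/

namespace PeriodPair

open ComplexConjugate AperiodicTop

variable (L : PeriodPair)

theorem weierstrassP_conj (h : ∀ l ∈ L.lattice, conj l ∈ L.lattice) (z : ℂ) :
    conj (L.weierstrassP z) = L.weierstrassP (conj z) := by
  let e : L.lattice ≃ L.lattice :=
    Function.Involutive.toPerm (fun l ↦ ⟨conj (l : ℂ), h l l.2⟩) fun l ↦ by ext; simp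
  simp only [weierstrassP]
  rw [Complex.conj_tsum, ← e.tsum_eq]
  congr 1
  ext l
  change conj (1 / (z - conj (l : ℂ)) ^ 2 - 1 / conj (l : ℂ) ^ 2) = _
  simp

/-- A segment on which `℘` is real gives an arc of the cubic, after a change of sign when the
segment is vertical. -/
theorem isCubicArc_weierstrassP {c d : ℂ} {σ B a₁ a₂ a₃ : ℝ} (hσ : σ ^ 2 = 1)
    (hd : d ^ 2 = σ) (hB : 0 < B)
    (hreal : ∀ x : ℝ, conj (L.weierstrassP (c + x * d)) = L.weierstrassP (c + x * d))
    (hL : ∀ x ∈ Icc 0 B, c + (x : ℂ) * d ∉ L.lattice)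
    (h2 : ∀ x ∈ Ioo 0 B, 2 * (c + (x : ℂ) * d) ∉ L.lattice)
    (hode : ∀ z ∉ L.lattice, L.derivWeierstrassP z ^ 2 = 4 * (L.weierstrassP z - a₁) *
        (L.weierstrassP z - a₂) * (L.weierstrassP z - a₃))
    (hl : L.weierstrassP c = a₁) (hr : L.weierstrassP (c + B * d) = a₂) :
    IsCubicArc (σ * a₁) (σ * a₂) (σ * a₃) B (fun x ↦ σ * (L.weierstrassP (c + x * d)).re)
      (fun x ↦ σ * (d * L.derivWeierstrassP (c + x * d)).re) := by
  have hre : ∀ x : ℝ, (((L.weierstrassP (c + x * d)).re : ℝ) : ℂ) = L.weierstrassP (c + x * d) :=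
    fun x ↦ Complex.conj_eq_iff_re.mp (hreal x)
  have hder : ∀ x ∈ Icc 0 B, HasDerivAt (fun x : ℝ ↦ L.weierstrassP (c + x * d))
      (d * L.derivWeierstrassP (c + x * d)) x := fun x hx ↦ by
    have h1 : HasDerivAt (fun x : ℝ ↦ c + (x : ℂ) * d) d x := by
      have := ((hasDerivAt_id x).ofReal_comp.mul_const d).const_add c
      simpa using this
    have := (L.hasDerivAt_weierstrassP (hL x hx)).comp x h1
    rw [mul_comm]; exact this
  have hderre : ∀ x ∈ Icc 0 B, HasDerivAt (fun x : ℝ ↦ (L.weierstrassP (c + x * d)).re)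
      (d * L.derivWeierstrassP (c + x * d)).re x := fun x hx ↦
    Complex.reCLM.hasFDerivAt.comp_hasDerivAt x (hder x hx)
  -- A real-valued function of a real variable has a real derivative.
  have hderreal : ∀ x ∈ Icc 0 B, (((d * L.derivWeierstrassP (c + x * d)).re : ℝ) : ℂ) =
      d * L.derivWeierstrassP (c + x * d) := fun x hx ↦ by
    have h1 := (hderre x hx).ofReal_comp
    simp only [hre] at h1
    exact h1.unique (hder x hx)
  have hσ0 : σ ≠ 0 := by rintro rfl; norm_num at hσ
  have hσC : (σ : ℂ) ^ 2 = 1 := by exact_mod_cast hσ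
  have hd0 : d ≠ 0 := by
    rintro rfl
    have : (σ : ℂ) ≠ 0 := by exact_mod_cast hσ0
    exact this (by simpa using hd.symm)
  refine ⟨hB, fun x hx ↦ ?_, fun x hx ↦ ?_, fun x hx ↦ ?_, fun x hx ↦ ?_, ?_, ?_⟩
  · exact ((hderre x hx).const_mul σ).continuousAt.continuousWithinAt
  · exact (hderre x (Ioo_subset_Icc_self hx)).const_mul σ
  · have hx' := Ioo_subset_Icc_self hx
    refine mul_ne_zero hσ0 fun h0 ↦ ?_
    have h1 := hderreal x hx'
    rw [h0, Complex.ofReal_zero, eq_comm, mul_eq_zero] at h1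
    exact h2 x hx (L.two_mul_mem_of_derivWeierstrassP_eq_zero (hL x hx') (h1.resolve_left hd0))
  · have hx' := Ioo_subset_Icc_self hx
    have h1 := hode _ (hL x hx')
    rw [← Complex.ofReal_inj]
    push_cast
    rw [hderreal x hx', hre x]
    generalize L.derivWeierstrassP (c + x * d) = Q at *
    generalize L.weierstrassP (c + x * d) = P at *
    calc ((σ : ℂ) * (d * Q)) ^ 2 = σ ^ 2 * d ^ 2 * Q ^ 2 := by ring
      _ = σ * Q ^ 2 := by rw [hσC, hd, one_mul]
      _ = σ ^ 2 * (σ * Q ^ 2) := by rw [hσC, one_mul]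
      _ = _ := by rw [h1]; ring
  · simp [hl]
  · simp [hr]

theorem mem_lattice_rect_iff {A B : ℝ} (h₁ : L.ω₁ = 2 * (Complex.I * A)) (h₂ : L.ω₂ = 2 * B)
    {x y : ℝ} : (x : ℂ) + y * Complex.I ∈ L.lattice ↔
      ∃ m n : ℤ, y = 2 * m * A ∧ x = 2 * n * B := by
  rw [mem_lattice, h₁, h₂]
  refine exists₂_congr fun m n ↦ ?_
  rw [Complex.ext_iff]
  simp only [Complex.add_re, Complex.mul_re, Complex.intCast_re, Complex.intCast_im,
    Complex.add_im, Complex.mul_im, Complex.I_re, Complex.I_im, Complex.ofReal_re,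
    Complex.ofReal_im, Complex.re_ofNat, Complex.im_ofNat]
  constructor
  · rintro ⟨h, h'⟩; constructor <;> linarith
  · rintro ⟨h, h'⟩; constructor <;> linarith

theorem rect_roots {A B : ℝ} (hA : 0 < A) (hB : 0 < B) (h₁ : L.ω₁ = 2 * (Complex.I * A))
    (h₂ : L.ω₂ = 2 * B) : ∃ a b c : ℝ, a < b ∧ b < c ∧ a + b + c = 0 ∧
      L.weierstrassP (B + A * Complex.I) = b ∧
      normalizedPeriod (c - a) (c - b) = B ∧ normalizedPeriod (c - a) (b - a) = A ∧
      L.g₂ = 4 * (a ^ 2 + a * b + b ^ 2) := by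
  have hmem : ∀ {x y : ℝ}, (x : ℂ) + y * Complex.I ∈ L.lattice ↔
      ∃ m n : ℤ, y = 2 * m * A ∧ x = 2 * n * B := L.mem_lattice_rect_iff h₁ h₂
  have hconj : ∀ l ∈ L.lattice, conj l ∈ L.lattice := fun l hl ↦ by
    obtain ⟨m, n, rfl⟩ := mem_lattice.mp hl
    refine mem_lattice.mpr ⟨-m, n, ?_⟩
    simp [h₁, h₂, map_ofNat]
  have tA : (((2 * B : ℝ) : ℂ) + ((0 : ℝ) : ℂ) * Complex.I) ∈ L.lattice :=
    hmem.mpr ⟨0, 1, by simp, by simp⟩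
  have tB : (((0 : ℝ) : ℂ) + ((2 * A : ℝ) : ℂ) * Complex.I) ∈ L.lattice :=
    hmem.mpr ⟨1, 0, by simp, by simp⟩
  -- On this horizontal line conjugation is translation by the period `-2Ai`.
  have hconjA : ∀ x : ℝ, conj (L.weierstrassP (A * Complex.I + x * 1)) =
      L.weierstrassP (A * Complex.I + x * 1) := fun x ↦ by
    rw [L.weierstrassP_conj hconj]
    have := L.weierstrassP_sub_coe (A * Complex.I + x * 1) ⟨_, tB⟩
    rw [← this]
    congr 1
    simp
    ring
  -- On this vertical line conjugation is `z ↦ 2B - z`, so evenness and periodicity of `℘` apply.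
  have hconjB : ∀ x : ℝ, conj (L.weierstrassP (B + x * Complex.I)) =
      L.weierstrassP (B + x * Complex.I) := fun x ↦ by
    rw [L.weierstrassP_conj hconj, ← L.weierstrassP_neg (B + x * Complex.I)]
    have := L.weierstrassP_add_coe (-(B + x * Complex.I)) ⟨_, tA⟩
    rw [← this]
    congr 1
    simp
    ring
  have hodd : ∀ {t C : ℝ} (n : ℤ), 0 < C → t = 2 * n * C → 0 < t → t < 2 * C → False := by
    intro t C n hC ht h0 h2
    subst ht
    have h0' : (0 : ℝ) < n := by
      by_contra! h; nlinarith
    have h2' : (n : ℝ) < 1 := by nlinarith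
    have a1 : 0 < n := by exact_mod_cast h0'
    have a2 : n < 1 := by exact_mod_cast h2'
    omega
  have hhor : ∀ x : ℝ, (A : ℂ) * Complex.I + x * 1 ∉ L.lattice := fun x h ↦ by
    have h' : (x : ℂ) + A * Complex.I ∈ L.lattice := by convert! h using 1; ring
    obtain ⟨m, -, hm, -⟩ := hmem.mp h'
    exact hodd m hA hm hA (by linarith)
  have hver : ∀ x : ℝ, (B : ℂ) + x * Complex.I ∉ L.lattice := fun x h ↦ by
    obtain ⟨-, m, -, hm⟩ := hmem.mp h
    exact hodd m hB hm hB (by linarith)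
  have hn1 : (A : ℂ) * Complex.I ∉ L.lattice := by simpa using hhor 0
  have hn2 : (B : ℂ) ∉ L.lattice := by simpa using hver 0
  have hn3 := hver A
  obtain ⟨a, ha⟩ : ∃ a : ℝ, L.weierstrassP (A * Complex.I) = a :=
    ⟨_, (Complex.conj_eq_iff_re.mp (by simpa using hconjA 0)).symm⟩
  obtain ⟨c, hc⟩ : ∃ a : ℝ, L.weierstrassP B = a :=
    ⟨_, (Complex.conj_eq_iff_re.mp (by simpa using hconjB 0)).symm⟩
  obtain ⟨b, hb⟩ : ∃ a : ℝ, L.weierstrassP (B + A * Complex.I) = a :=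
    ⟨_, (Complex.conj_eq_iff_re.mp (hconjB A)).symm⟩
  have t1 : 2 * ((A : ℂ) * Complex.I) ∈ L.lattice := by convert! tB using 1; push_cast; ring
  have t2 : 2 * (B : ℂ) ∈ L.lattice := by convert! tA using 1; push_cast; ring
  have t3 : 2 * ((B : ℂ) + A * Complex.I) ∈ L.lattice := by
    rw [mul_add]; exact add_mem t2 t1
  have d13 : (A : ℂ) * Complex.I - (B + A * Complex.I) ∉ L.lattice := by
    rwa [show (A : ℂ) * Complex.I - (B + A * Complex.I) = -B by ring, neg_mem_iff]
  have d12 : (A : ℂ) * Complex.I - B ∉ L.lattice := by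
    have := hhor (-B)
    convert! this using 2; push_cast; ring
  have d32 : (B + A * Complex.I) - (B : ℂ) ∉ L.lattice := by
    rwa [show (B + A * Complex.I) - (B : ℂ) = A * Complex.I by ring]
  obtain ⟨hsum, hode, hg⟩ := L.halfPeriod_relations hn1 hn3 hn2 t1 t3 t2 d13 d12 d32
  have ne13 := L.notMem_of_half hn1 t1 hn3 d13
  have ne32 := L.notMem_of_half hn3 t3 hn2 d32
  rw [ha, hb, hc] at hsum
  rw [ha, hb] at hg
  rw [ha, hb] at ne13
  rw [hb, hc] at ne32
  simp only [ha, hb, hc] at hode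
  -- The horizontal side, from `Ai` to `B + Ai`, joins the roots `a` and `b` and yields `b ≤ c`.
  have hH := L.isCubicArc_weierstrassP (c := A * Complex.I) (d := 1) (σ := 1) (a₁ := a) (a₂ := b)
    (a₃ := c) (by norm_num) (by norm_num) hB hconjA (fun x _ ↦ hhor x) (fun x hx h ↦ by
      have h' : ((2 * x : ℝ) : ℂ) + (2 * A : ℝ) * Complex.I ∈ L.lattice := by
        convert! h using 1; push_cast; ring
      obtain ⟨-, m, -, hm⟩ := hmem.mp h'
      exact hodd m hB hm (by linarith [hx.1]) (by linarith [hx.2])) hode ha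
    (by rw [← hb]; congr 1; ring)
  -- The vertical side, from `B` to `B + Ai`: since `i² = -1`, it is `-℘` that satisfies a cubic
  -- equation, with roots `-c`, `-b`, `-a`. This yields `a ≤ b`.
  have hV := L.isCubicArc_weierstrassP (c := B) (d := Complex.I) (σ := -1) (a₁ := c) (a₂ := b)
    (a₃ := a) (by norm_num) (by simp) hA hconjB (fun x _ ↦ hver x) (fun x hx h ↦ by
      have h' : ((2 * B : ℝ) : ℂ) + (2 * x : ℝ) * Complex.I ∈ L.lattice := by
        convert! h using 1; push_cast; ring
      obtain ⟨m, -, hm, -⟩ := hmem.mp h'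
      exact hodd m hA hm (by linarith [hx.1]) (by linarith [hx.2]))
    (fun z hz ↦ by rw [hode z hz]; ring) hc hb
  have hbc : b < c := by
    refine lt_of_le_of_ne (by linarith [hH.right_le]) fun h ↦ ne32 (by rw [h])
  have hab : a < b := by
    refine lt_of_le_of_ne (by linarith [hV.right_le]) fun h ↦ ne13 (by rw [h])
  have pH := hH.normalizedPeriod_eq (by linarith)
  have pV := hV.normalizedPeriod_eq (by linarith)
  refine ⟨a, b, c, hab, hbc, by exact_mod_cast hsum, hb, ?_, ?_, hg⟩
  · convert! pH using 2 <;> ring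
  · convert! pV using 2 <;> ring

end PeriodPair

/-! ### The lattice of the cycle integrals belongs to the curve. -/

namespace AperiodicTop

/-- The lattice of the cycle integrals uniformizes the curve `w² = R(u)`. -/
theorem periods_uniformize {e₁ e₄ : ℝ} (h₁ : -e₄ < e₁) (h₂ : e₁ < e₄) :
    (periods e₁ e₄ h₁ h₂).weierstrassP
        (realHalfPeriod e₁ e₄ + imagHalfPeriod e₁ e₄ * Complex.I) = 2 * e₁ / 3 ∧
      (periods e₁ e₄ h₁ h₂).g₂ = 4 * ((e₁ : ℂ) ^ 2 / 3 + (e₄ : ℂ) ^ 2) := by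
  obtain ⟨a, b, c, hab, hbc, hsum, hb, pB, pA, hg⟩ := (periods e₁ e₄ h₁ h₂).rect_roots
    (imagHalfPeriod_pos h₁ h₂) (realHalfPeriod_pos h₁ h₂) rfl rfl
  rw [realHalfPeriod_eq h₁, show c - a = b - a + (c - b) by ring] at pB
  rw [imagHalfPeriod_eq h₂, show c - a = b - a + (c - b) by ring] at pA
  -- The gaps come out as `b - a = e₁ + e₄` and `c - b = e₄ - e₁`; together with `a + b + c = 0`
  -- they fix all three roots.
  obtain ⟨hp, hq⟩ := normalizedPeriod_injective (by linarith) (by linarith) (by linarith)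
    (by linarith) pB pA
  have eb : b = 2 * e₁ / 3 := by linarith
  have ea : a = -e₄ - e₁ / 3 := by linarith
  have ec : c = e₄ - e₁ / 3 := by linarith
  subst ea eb ec
  refine ⟨by rw [hb]; push_cast; ring, ?_⟩
  rw [hg]
  push_cast
  ring

end AperiodicTop

/-! ### Abelian integrals along paths that may pass through branch points. -/

namespace AperiodicTop

open Filter Topology MeasureTheory

/-- Half the derivative of the cubic `R`. -/
def halfDerivCubic (e₁ e₄ u : ℂ) : ℂ := 2 * (3 * u ^ 2 - 2 * e₁ * u - e₄ ^ 2)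

theorem hasDerivAt_cubic (e₁ e₄ u : ℂ) :
    HasDerivAt (cubic e₁ e₄) (2 * halfDerivCubic e₁ e₄ u) u := by
  have h1 := ((hasDerivAt_id u).sub_const e₁).const_mul 4
  have h2 := (((hasDerivAt_id u).pow 2).sub_const (e₄ ^ 2))
  refine (h1.mul h2).congr_deriv ?_
  simp [halfDerivCubic]
  ring

theorem halfDerivCubic_ne_zero {e₁ e₄ : ℝ} (h₁ : -e₄ < e₁) (h₂ : e₁ < e₄) {u : ℂ}
    (hu : cubic (e₁ : ℂ) (e₄ : ℂ) u = 0) : halfDerivCubic e₁ e₄ u ≠ 0 := by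
  have n1 : (e₄ : ℂ) - e₁ ≠ 0 := by
    rw [← Complex.ofReal_sub]; exact_mod_cast (sub_pos.mpr h₂).ne'
  have n2 : (e₄ : ℂ) + e₁ ≠ 0 := by
    rw [← Complex.ofReal_add]
    have : e₄ + e₁ ≠ 0 := by linarith
    exact_mod_cast this
  have n3 : (e₄ : ℂ) ≠ 0 := by
    have : e₄ ≠ 0 := by linarith
    exact_mod_cast this
  have hfac : (u - e₁) * ((u - e₄) * (u + e₄)) = 0 := by
    simp only [cubic] at hu
    linear_combination hu / 4
  rcases mul_eq_zero.mp hfac with h | h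
  · obtain rfl := sub_eq_zero.mp h
    have : halfDerivCubic e₁ e₄ e₁ = -2 * ((e₄ - e₁) * (e₄ + e₁)) := by
      simp only [halfDerivCubic]; ring
    rw [this]
    exact mul_ne_zero (by norm_num) (mul_ne_zero n1 n2)
  · rcases mul_eq_zero.mp h with h | h
    · obtain rfl := sub_eq_zero.mp h
      have : halfDerivCubic e₁ e₄ e₄ = 4 * (e₄ * (e₄ - e₁)) := by
        simp only [halfDerivCubic]; ring
      rw [this]
      exact mul_ne_zero (by norm_num) (mul_ne_zero n3 n1)
    · obtain rfl := eq_neg_of_add_eq_zero_left h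
      have : halfDerivCubic e₁ e₄ (-e₄) = 4 * (e₄ * (e₄ + e₁)) := by
        simp only [halfDerivCubic]; ring
      rw [this]
      exact mul_ne_zero (by norm_num) (mul_ne_zero n3 n2)

theorem hasDerivWithinAt_integral_Icc {g : ℝ → ℂ} (hg : ContinuousOn g (Icc 0 1)) {τ : ℝ}
    (hτ : τ ∈ Icc (0 : ℝ) 1) :
    HasDerivWithinAt (fun T => ∫ t in (0 : ℝ)..T, g t) (g τ) (Icc 0 1) τ := by
  set G : ℝ → ℂ := IccExtend zero_le_one ((Icc (0 : ℝ) 1).domRestrict g) with hG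
  have hGc : Continuous G := (continuousOn_iff_continuous_domRestrict.mp hg).Icc_extend'
  have hGg : ∀ t ∈ Icc (0 : ℝ) 1, G t = g t := fun t ht => by
    rw [hG, IccExtend_of_mem _ _ ht, domRestrict_apply]
  have hd := (hGc.integral_hasStrictDerivAt 0 τ).hasDerivAt.hasDerivWithinAt (s := Icc 0 1)
  rw [hGg τ hτ] at hd
  have hcongr : ∀ T ∈ Icc (0 : ℝ) 1, ∫ t in (0 : ℝ)..T, g t = ∫ t in (0 : ℝ)..T, G t :=
    fun T hT => intervalIntegral.integral_congr fun t ht => by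
      rw [uIcc_of_le hT.1] at ht
      exact (hGg t ⟨ht.1, ht.2.trans hT.2⟩).symm
  exact hd.congr hcongr (hcongr τ hτ)

theorem eq_of_hasDerivWithinAt_zero {g : ℝ → ℂ}
    (hg : ∀ τ ∈ Icc (0 : ℝ) 1, HasDerivWithinAt g 0 (Icc 0 1) τ) {T : ℝ} (hT : T ∈ Icc (0 : ℝ) 1) :
    g T = g 0 :=
  constant_of_derivWithin_zero (fun τ hτ => (hg τ hτ).differentiableWithinAt)
    (fun τ hτ => (hg τ (Ico_subset_Icc_self hτ)).derivWithin
      (uniqueDiffOn_Icc zero_lt_one τ (Ico_subset_Icc_self hτ))) T hT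

/-- A zero with nonzero derivative is isolated, and a discrete subset of the line is countable. -/
theorem countable_zeros_of_derivWithin_ne_zero {w : ℝ → ℂ} (hw : DifferentiableOn ℝ w (Icc 0 1)) :
    {τ ∈ Icc (0 : ℝ) 1 | w τ = 0 ∧ derivWithin w (Icc 0 1) τ ≠ 0}.Countable := by
  set S := {τ ∈ Icc (0 : ℝ) 1 | w τ = 0 ∧ derivWithin w (Icc 0 1) τ ≠ 0}
  have : DiscreteTopology S := by
    rw [discreteTopology_subtype_iff]
    rintro τ ⟨hτ, h0, h1⟩
    have h := (hw τ hτ).hasDerivWithinAt.eventually_ne (c := 0) h1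
    rw [inf_principal_eq_bot]
    have h2 : Icc (0 : ℝ) 1 \ {τ} = {τ}ᶜ ∩ Icc 0 1 := by
      ext; simp [and_comm]
    rw [h2, nhdsWithin_inter', eventually_inf_principal] at h
    filter_upwards [h] with t ht hS
    exact ht hS.1 hS.2.1
  exact (countable_coe_iff).mp (TopologicalSpace.separableSpace_iff_countable.mp inferInstance)

namespace CurvePath

variable {e₁ e₄ : ℝ} (γ : CurvePath e₁ e₄)

/-- The velocity of the uniformizing variable along the path, extended continuously through the
branch points. -/
noncomputable def rate (τ : ℝ) : ℂ :=
  open Classical in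
  if γ.w τ = 0 then derivWithin γ.w (Icc 0 1) τ / halfDerivCubic e₁ e₄ (γ.u τ)
  else derivWithin γ.u (Icc 0 1) τ / γ.w τ

theorem hasDerivWithinAt_u {τ : ℝ} (hτ : τ ∈ Icc (0 : ℝ) 1) :
    HasDerivWithinAt γ.u (derivWithin γ.u (Icc 0 1) τ) (Icc 0 1) τ :=
  ((γ.contDiffOn_u.differentiableOn one_ne_zero) τ hτ).hasDerivWithinAt

theorem hasDerivWithinAt_w {τ : ℝ} (hτ : τ ∈ Icc (0 : ℝ) 1) :
    HasDerivWithinAt γ.w (derivWithin γ.w (Icc 0 1) τ) (Icc 0 1) τ :=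
  ((γ.contDiffOn_w.differentiableOn one_ne_zero) τ hτ).hasDerivWithinAt

theorem w_mul_derivWithin_w {τ : ℝ} (hτ : τ ∈ Icc (0 : ℝ) 1) :
    γ.w τ * derivWithin γ.w (Icc 0 1) τ =
      halfDerivCubic e₁ e₄ (γ.u τ) * derivWithin γ.u (Icc 0 1) τ := by
  have d1 := (γ.hasDerivWithinAt_w hτ).pow 2
  have d2 := (hasDerivAt_cubic e₁ e₄ (γ.u τ)).comp_hasDerivWithinAt τ (γ.hasDerivWithinAt_u hτ)
  have d3 := d2.congr (f₁ := γ.w ^ 2) (fun t ht => γ.mem_curve t ht) (γ.mem_curve τ hτ)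
  have e := (uniqueDiffOn_Icc zero_lt_one τ hτ).eq_deriv _ d1 d3
  simp only [Nat.cast_ofNat, Nat.add_one_sub_one, pow_one] at e
  linear_combination e / 2

theorem halfDerivCubic_u_ne_zero (h₁ : -e₄ < e₁) (h₂ : e₁ < e₄) {τ : ℝ} (hτ : τ ∈ Icc (0 : ℝ) 1)
    (hw : γ.w τ = 0) : halfDerivCubic e₁ e₄ (γ.u τ) ≠ 0 :=
  halfDerivCubic_ne_zero h₁ h₂ (by rw [← γ.mem_curve τ hτ, hw]; simp)

theorem derivWithin_u_eq (h₁ : -e₄ < e₁) (h₂ : e₁ < e₄) {τ : ℝ} (hτ : τ ∈ Icc (0 : ℝ) 1) :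
    derivWithin γ.u (Icc 0 1) τ = γ.w τ * γ.rate τ := by
  by_cases hw : γ.w τ = 0
  · have := γ.w_mul_derivWithin_w hτ
    rw [hw, zero_mul, zero_eq_mul] at this
    rw [hw, zero_mul]
    exact this.resolve_left (γ.halfDerivCubic_u_ne_zero h₁ h₂ hτ hw)
  · rw [rate, if_neg hw]; field_simp

theorem derivWithin_w_eq (h₁ : -e₄ < e₁) (h₂ : e₁ < e₄) {τ : ℝ} (hτ : τ ∈ Icc (0 : ℝ) 1) :
    derivWithin γ.w (Icc 0 1) τ = halfDerivCubic e₁ e₄ (γ.u τ) * γ.rate τ := by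
  by_cases hw : γ.w τ = 0
  · have := γ.halfDerivCubic_u_ne_zero h₁ h₂ hτ hw
    rw [rate, if_pos hw]; field_simp
  · have := γ.w_mul_derivWithin_w hτ
    rw [rate, if_neg hw]
    field_simp
    linear_combination this

/-- Differentiating `w² = R(u)` gives `w w' = (R'/2) u'`, so `u'/w` and `w'/(R'/2)` agree wherever
both make sense. The roots of `R` are simple, so near every point one of the two expressions is
continuous. -/
theorem continuousOn_rate (h₁ : -e₄ < e₁) (h₂ : e₁ < e₄) : ContinuousOn γ.rate (Icc 0 1) := by
  have cu := γ.contDiffOn_u.continuousOn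
  have cw := γ.contDiffOn_w.continuousOn
  have cu' := γ.contDiffOn_u.continuousOn_derivWithin (uniqueDiffOn_Icc zero_lt_one) le_rfl
  have cw' := γ.contDiffOn_w.continuousOn_derivWithin (uniqueDiffOn_Icc zero_lt_one) le_rfl
  have cD : ContinuousOn (fun τ => halfDerivCubic e₁ e₄ (γ.u τ)) (Icc 0 1) := by
    unfold halfDerivCubic; fun_prop
  intro τ hτ
  by_cases hw : γ.w τ = 0
  · have hD := γ.halfDerivCubic_u_ne_zero h₁ h₂ hτ hw
    have heq : ∀ t ∈ Icc (0 : ℝ) 1, halfDerivCubic e₁ e₄ (γ.u t) ≠ 0 →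
        γ.rate t = derivWithin γ.w (Icc 0 1) t / halfDerivCubic e₁ e₄ (γ.u t) := fun t ht h => by
      rw [γ.derivWithin_w_eq h₁ h₂ ht]; field_simp
    refine ((cw' τ hτ).div (cD τ hτ) hD).congr_of_eventuallyEq ?_ (heq τ hτ hD)
    filter_upwards [(cD τ hτ).eventually_ne hD, self_mem_nhdsWithin] with t h ht
    exact heq t ht h
  · refine ((cu' τ hτ).div (cw τ hτ) hw).congr_of_eventuallyEq ?_ (if_neg hw)
    filter_upwards [(cw τ hτ).eventually_ne hw] with t h
    exact if_neg h

/-- The two functions can differ only where `w = 0` and `w' ≠ 0`, a countable set. Integrals may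
therefore use the continuous `rate`. -/
theorem ae_density_eq (f : ℂ → ℂ) :
    ∀ᵐ τ, τ ∈ Icc (0 : ℝ) 1 → γ.density f τ = f (γ.u τ) * γ.rate τ := by
  have hc := (countable_zeros_of_derivWithin_ne_zero
    (γ.contDiffOn_w.differentiableOn one_ne_zero)).ae_notMem volume
  filter_upwards [hc] with τ hn hτ
  rw [density, rate]
  split_ifs with hw
  · have : derivWithin γ.w (Icc 0 1) τ = 0 := by
      by_contra h; exact hn ⟨hτ, hw, h⟩
    rw [hw, this]; simp
  · rfl

theorem continuousOn_mul_rate (h₁ : -e₄ < e₁) (h₂ : e₁ < e₄) {f : ℂ → ℂ}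
    (hf : ContinuousOn (fun τ => f (γ.u τ)) (Icc 0 1)) :
    ContinuousOn (fun τ => f (γ.u τ) * γ.rate τ) (Icc 0 1) :=
  hf.mul (γ.continuousOn_rate h₁ h₂)

theorem intervalIntegrable_density (h₁ : -e₄ < e₁) (h₂ : e₁ < e₄) {f : ℂ → ℂ}
    (hf : ContinuousOn (fun τ => f (γ.u τ)) (Icc 0 1)) :
    IntervalIntegrable (γ.density f) volume 0 1 := by
  have := (γ.continuousOn_mul_rate h₁ h₂ hf).intervalIntegrable_of_Icc (μ := volume) zero_le_one
  refine this.congr_ae ?_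
  rw [uIoc_of_le zero_le_one]
  refine (ae_restrict_iff' measurableSet_Ioc).mpr ?_
  filter_upwards [γ.ae_density_eq f] with τ h hτ
  exact (h (Ioc_subset_Icc_self hτ)).symm

theorem abelianIntegral_eq (f : ℂ → ℂ) {T : ℝ}
    (hT : T ∈ Icc (0 : ℝ) 1) :
    γ.abelianIntegral f T = ∫ τ in (0 : ℝ)..T, f (γ.u τ) * γ.rate τ := by
  refine intervalIntegral.integral_congr_ae ?_
  filter_upwards [γ.ae_density_eq f] with τ h hτ
  rw [uIoc_of_le hT.1] at hτ
  exact h ⟨hτ.1.le, hτ.2.trans hT.2⟩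

theorem hasDerivWithinAt_abelianIntegral (h₁ : -e₄ < e₁) (h₂ : e₁ < e₄) {f : ℂ → ℂ}
    (hf : ContinuousOn (fun τ => f (γ.u τ)) (Icc 0 1)) {τ : ℝ} (hτ : τ ∈ Icc (0 : ℝ) 1) :
    HasDerivWithinAt (γ.abelianIntegral f) (f (γ.u τ) * γ.rate τ) (Icc 0 1) τ :=
  (hasDerivWithinAt_integral_Icc (γ.continuousOn_mul_rate h₁ h₂ hf) hτ).congr
    (fun _ hT => γ.abelianIntegral_eq f hT) (γ.abelianIntegral_eq f hτ)

theorem abelianIntegral_zero (f : ℂ → ℂ) : γ.abelianIntegral f 0 = 0 :=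
  intervalIntegral.integral_same

theorem hasDerivWithinAt_x (h₁ : -e₄ < e₁) (h₂ : e₁ < e₄) {τ : ℝ} (hτ : τ ∈ Icc (0 : ℝ) 1) :
    HasDerivWithinAt γ.x (γ.rate τ) (Icc 0 1) τ := by
  have := γ.hasDerivWithinAt_abelianIntegral h₁ h₂ (f := fun _ => 1) continuousOn_const hτ
  rwa [one_mul] at this

theorem x_zero : γ.x 0 = 0 := γ.abelianIntegral_zero _

theorem w_zero : γ.w 0 = 0 := by
  have := γ.mem_curve 0 (left_mem_Icc.mpr zero_le_one)
  simpa [γ.u_zero, cubic] using this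

/-! ### Uniformization of a path by uniqueness for an ordinary differential equation. -/

/-- The vector field of the curve, whose flow is the uniformization. -/
def flowField (e₁ e₄ : ℝ) (y : ℂ × ℂ) : ℂ × ℂ := (y.2, halfDerivCubic e₁ e₄ y.1)

theorem contDiff_flowField (e₁ e₄ : ℝ) : ContDiff ℝ 1 (flowField e₁ e₄) := by
  unfold flowField halfDerivCubic
  fun_prop

variable (L : PeriodPair) {ω : ℂ}

/-- The parameters up to which the path is uniformized by `℘`. -/
def uniformizedSet (ω : ℂ) : Set ℝ :=
  {τ | γ.x τ - ω ∉ L.lattice ∧ γ.u τ = L.weierstrassP (γ.x τ - ω) + e₁ / 3 ∧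
    γ.w τ = L.derivWeierstrassP (γ.x τ - ω)}

/-- At a pole `z₀` the product `(z - z₀)² ℘(z)` tends to `1`, but it would tend to `0` if `℘(z)` had
a finite limit. Thus a path on the affine curve never reaches a lattice point. -/
theorem notMem_lattice_of_tendsto {l : Filter ℝ} [l.NeBot] {z p : ℝ → ℂ} {z₀ p₀ : ℂ}
    (hz : Tendsto z l (𝓝 z₀)) (hp : Tendsto p l (𝓝 p₀))
    (h : ∀ᶠ τ in l, z τ ∉ L.lattice ∧ p τ = L.weierstrassP (z τ)) : z₀ ∉ L.lattice := by
  intro hz₀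
  have c1 : ContinuousAt (L.weierstrassPExcept z₀) z₀ :=
    (L.analyticAt_weierstrassPExcept z₀).continuousAt
  have t0 : Tendsto (fun τ => (z τ - z₀) ^ 2) l (𝓝 0) := by
    have := (hz.sub_const z₀).pow 2
    simpa using this
  have t1 := t0.mul hp
  have t2 := ((t0.mul (c1.tendsto.comp hz)).add_const 1).sub (t0.div_const (z₀ ^ 2))
  have heq : ∀ᶠ τ in l, (z τ - z₀) ^ 2 * p τ =
      (z τ - z₀) ^ 2 * (L.weierstrassPExcept z₀ ∘ z) τ + 1 - (z τ - z₀) ^ 2 / z₀ ^ 2 := by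
    filter_upwards [h] with τ hτ
    have hne : z τ ≠ z₀ := fun e => hτ.1 (e ▸ hz₀)
    have := L.ite_eq_one_sub_sq_mul_weierstrassP z₀ hz₀ (z τ)
    rw [if_neg hne] at this
    rw [hτ.2, this, Function.comp_apply]
  have := tendsto_nhds_unique (t1.congr' heq) t2
  simp at this

theorem isClosed_uniformizedSet (h₁ : -e₄ < e₁) (h₂ : e₁ < e₄) :
    IsClosed (γ.uniformizedSet L ω ∩ Icc 0 1) := by
  refine isClosed_of_closure_subset fun τ hτ => ?_
  have hτI : τ ∈ Icc (0 : ℝ) 1 :=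
    closure_minimal inter_subset_right isClosed_Icc hτ
  set S := γ.uniformizedSet L ω ∩ Icc 0 1
  have : (𝓝[S] τ).NeBot := mem_closure_iff_nhdsWithin_neBot.mp hτ
  have hle : 𝓝[S] τ ≤ 𝓝[Icc 0 1] τ := nhdsWithin_mono _ inter_subset_right
  have tx : Tendsto (fun t => γ.x t - ω) (𝓝[S] τ) (𝓝 (γ.x τ - ω)) :=
    ((γ.hasDerivWithinAt_x h₁ h₂ hτI).continuousWithinAt.tendsto.mono_left hle).sub_const ω
  have tu : Tendsto γ.u (𝓝[S] τ) (𝓝 (γ.u τ)) :=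
    (γ.contDiffOn_u.continuousOn τ hτI).tendsto.mono_left hle
  have tw : Tendsto γ.w (𝓝[S] τ) (𝓝 (γ.w τ)) :=
    (γ.contDiffOn_w.continuousOn τ hτI).tendsto.mono_left hle
  have hmem : ∀ᶠ t in 𝓝[S] τ, t ∈ S := self_mem_nhdsWithin
  have hn : γ.x τ - ω ∉ L.lattice := by
    refine notMem_lattice_of_tendsto L tx (tu.sub_const (e₁ / 3 : ℂ)) ?_
    filter_upwards [hmem] with t ht
    exact ⟨ht.1.1, by rw [ht.1.2.1, add_sub_cancel_right]⟩
  refine ⟨⟨hn, ?_, ?_⟩, hτI⟩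
  · refine tendsto_nhds_unique tu ((((L.hasDerivAt_weierstrassP hn).continuousAt.tendsto.comp
      tx).add_const (e₁ / 3 : ℂ)).congr' ?_)
    filter_upwards [hmem] with t ht using ht.1.2.1.symm
  · refine tendsto_nhds_unique tw (((L.hasDerivAt_derivWeierstrassP hn).continuousAt.tendsto.comp
      tx).congr' ?_)
    filter_upwards [hmem] with t ht using ht.1.2.2.symm

/-- Both `(u, w)` and its expression through `℘` solve `y' = rate · flowField y`, the second because
`℘'' = 6℘² - g₂/2`; only `g₂` enters. The field is locally Lipschitz and `rate` is bounded, so the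
solutions agree for a short time. -/
theorem uniformizedSet_mem_nhdsGT (h₁ : -e₄ < e₁) (h₂ : e₁ < e₄)
    (hg : L.g₂ = 4 * ((e₁ : ℂ) ^ 2 / 3 + (e₄ : ℂ) ^ 2)) {τ : ℝ}
    (hτ : τ ∈ γ.uniformizedSet L ω ∩ Ico 0 1) : γ.uniformizedSet L ω ∈ 𝓝[>] τ := by
  obtain ⟨⟨hn, hu, hw⟩, hτI⟩ := hτ
  have hτI' := Ico_subset_Icc_self hτI
  set f : ℝ → ℂ × ℂ := fun t => (γ.u t, γ.w t) with hf
  set g : ℝ → ℂ × ℂ := fun t =>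
    (L.weierstrassP (γ.x t - ω) + e₁ / 3, L.derivWeierstrassP (γ.x t - ω)) with hgdef
  have hfg : f τ = g τ := by simp only [hf, hgdef, hu, hw]
  obtain ⟨K, s, hs, hK⟩ :=
    ((contDiff_flowField e₁ e₄).contDiffAt (x := f τ)).exists_lipschitzOnWith
  obtain ⟨M, hM⟩ := isCompact_Icc.exists_bound_of_continuousOn (γ.continuousOn_rate h₁ h₂)
  have df : ∀ t ∈ Icc (0 : ℝ) 1,
      HasDerivWithinAt f (γ.rate t • flowField e₁ e₄ (f t)) (Icc 0 1) t := fun t ht => by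
    refine ((γ.hasDerivWithinAt_u ht).prodMk (γ.hasDerivWithinAt_w ht)).congr_deriv ?_
    rw [γ.derivWithin_u_eq h₁ h₂ ht, γ.derivWithin_w_eq h₁ h₂ ht]
    simp only [hf, flowField, Prod.smul_mk, smul_eq_mul, mul_comm]
  have dg : ∀ t ∈ Icc (0 : ℝ) 1, γ.x t - ω ∉ L.lattice →
      HasDerivWithinAt g (γ.rate t • flowField e₁ e₄ (g t)) (Icc 0 1) t := fun t ht hl => by
    have dx := (γ.hasDerivWithinAt_x h₁ h₂ ht).sub_const ω
    have d1 := ((L.hasDerivAt_weierstrassP hl).comp_hasDerivWithinAt t dx).add_const (e₁ / 3 : ℂ)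
    have d2 := (L.hasDerivAt_derivWeierstrassP hl).comp_hasDerivWithinAt t dx
    refine (d1.prodMk d2).congr_deriv ?_
    simp only [hgdef, flowField, Prod.smul_mk, smul_eq_mul, halfDerivCubic, hg]
    refine Prod.ext (by simp only []; ring) (by simp only []; ring)
  have hev : ∀ᶠ t in 𝓝[Icc 0 1] τ, f t ∈ s ∧ g t ∈ s ∧ γ.x t - ω ∉ L.lattice := by
    have e1 := (df τ hτI').continuousWithinAt.eventually_mem hs
    have e2 := (dg τ hτI' hn).continuousWithinAt.eventually_mem (hfg ▸ hs)
    have e3 := ((γ.hasDerivWithinAt_x h₁ h₂ hτI').sub_const ω).continuousWithinAt.eventually_mem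
      (L.isOpen_compl_lattice.mem_nhds hn)
    filter_upwards [e1, e2, e3] with t a b c using ⟨a, b, c⟩
  have hev' : ∀ᶠ t in 𝓝[≥] τ, f t ∈ s ∧ g t ∈ s ∧ γ.x t - ω ∉ L.lattice := by
    rw [← nhdsWithin_Icc_eq_nhdsGE hτI.2]
    exact nhdsWithin_mono _ (Icc_subset_Icc_left hτI.1) hev
  obtain ⟨c, hc, hcs⟩ := mem_nhdsGE_iff_exists_Icc_subset.mp
    (inter_mem hev' (Icc_mem_nhdsGE hτI.2))
  have hIcc : ∀ t ∈ Icc τ c, t ∈ Icc (0 : ℝ) 1 := fun t ht =>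
    ⟨hτI.1.trans ht.1, (hcs ht).2.2⟩
  have hsub : Icc τ c ⊆ Icc 0 1 := hIcc
  have hnhds : ∀ t ∈ Ico τ c, Icc (0 : ℝ) 1 ∈ 𝓝[≥] t := fun t ht =>
    mem_of_superset (Icc_mem_nhdsGE (ht.2.trans_le (hIcc c (right_mem_Icc.mpr hc.le)).2))
      (Icc_subset_Icc_left (hτI.1.trans ht.1))
  have heq : EqOn f g (Icc τ c) := by
    refine ODE_solution_unique_of_mem_Icc_right (K := M.toNNReal * K)
      (v := fun t y => γ.rate t • flowField e₁ e₄ y) (s := fun _ => s) (fun t ht => ?_)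
      (fun t ht => (df t (hIcc t ht)).continuousWithinAt.mono hsub)
      (fun t ht => (df t (hIcc t (Ico_subset_Icc_self ht))).mono_of_mem_nhdsWithin (hnhds t ht))
      (fun t ht => (hcs (Ico_subset_Icc_self ht)).1.1)
      (fun t ht => (dg t (hIcc t ht) (hcs ht).1.2.2).continuousWithinAt.mono hsub)
      (fun t ht => (dg t (hIcc t (Ico_subset_Icc_self ht))
        (hcs (Ico_subset_Icc_self ht)).1.2.2).mono_of_mem_nhdsWithin (hnhds t ht))
      (fun t ht => (hcs (Ico_subset_Icc_self ht)).1.2.1) hfg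
    refine LipschitzOnWith.of_dist_le_mul fun y hy y' hy' => ?_
    have hM' := hM t (hIcc t (Ico_subset_Icc_self ht))
    rw [dist_eq_norm, ← smul_sub, norm_smul, ← dist_eq_norm]
    have := hK.dist_le_mul y hy y' hy'
    have hM0 : 0 ≤ M := (norm_nonneg _).trans hM'
    rw [NNReal.coe_mul, Real.coe_toNNReal M hM0, mul_assoc]
    gcongr
  refine mem_of_superset (Icc_mem_nhdsGT hc) fun t ht => ?_
  have h := heq ht
  exact ⟨(hcs ht).1.2.2, congrArg Prod.fst h, congrArg Prod.snd h⟩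

/-- Along the path, `u = ℘(x - ω) + e₁ / 3` and `w = ℘'(x - ω)`. -/
theorem mem_uniformizedSet (h₁ : -e₄ < e₁) (h₂ : e₁ < e₄) (hω : ω ∉ L.lattice)
    (hω2 : 2 * ω ∈ L.lattice) (hP : L.weierstrassP ω = 2 * e₁ / 3)
    (hg : L.g₂ = 4 * ((e₁ : ℂ) ^ 2 / 3 + (e₄ : ℂ) ^ 2)) {τ : ℝ} (hτ : τ ∈ Icc (0 : ℝ) 1) :
    τ ∈ γ.uniformizedSet L ω := by
  refine (γ.isClosed_uniformizedSet L h₁ h₂).Icc_subset_of_forall_mem_nhdsWithin ?_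
    (fun t ht => γ.uniformizedSet_mem_nhdsGT L h₁ h₂ hg ht) hτ
  refine ⟨?_, ?_, ?_⟩
  · simpa [γ.x_zero] using hω
  · rw [γ.x_zero, zero_sub, L.weierstrassP_neg, hP, γ.u_zero]; ring
  · rw [γ.x_zero, zero_sub, L.derivWeierstrassP_neg, L.derivWeierstrassP_eq_zero hω2, γ.w_zero,
      neg_zero]

end CurvePath

end AperiodicTop

/-! ### The time integral in terms of zeta and sigma functions. -/

namespace AperiodicTop

namespace CurvePath

variable {e₁ e₄ : ℝ} (γ : CurvePath e₁ e₄) (L : PeriodPair) {ω b wPlus : ℂ}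

/-- The reduction of `(u² - e₄²) / (u - 1)` to zeta functions. -/
theorem time_integrand_eq (hω : ω ∉ L.lattice) (hω2 : 2 * ω ∈ L.lattice)
    (hw : wPlus ≠ 0) (hv : b - ω ∉ L.lattice)
    (hu1 : (1 : ℂ) = L.weierstrassP (b - ω) + e₁ / 3)
    (hwP : wPlus = L.derivWeierstrassP (b - ω)) {x u : ℂ} (hx : x - ω ∉ L.lattice)
    (hu : u = L.weierstrassP (x - ω) + e₁ / 3) (hne : u ≠ 1) :
    x - b ∉ L.lattice ∧ x + b ∉ L.lattice ∧
      (u ^ 2 - (e₄ : ℂ) ^ 2) / (u - 1) = L.weierstrassP (x - ω) + (1 + (e₁ : ℂ) / 3) +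
        (1 - (e₄ : ℂ) ^ 2) / wPlus * (L.weierstrassZeta (x - b) - L.weierstrassZeta (x + b) +
          2 * (L.weierstrassZeta ω + L.weierstrassZeta (b - ω))) := by
  have hsub : L.weierstrassP (x - ω) - L.weierstrassP (b - ω) = u - 1 := by
    linear_combination hu1 - hu
  have hne' : u - 1 ≠ 0 := sub_ne_zero.mpr hne
  have n1 : x - ω - (b - ω) ∉ L.lattice := fun h => by
    have := L.weierstrassP_sub_coe (x - ω) ⟨_, h⟩
    rw [sub_sub_cancel] at this
    exact hne' (by rw [← hsub, this, sub_self])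
  have n2 : x - ω + (b - ω) ∉ L.lattice := fun h => by
    have := L.weierstrassP_sub_coe (x - ω) ⟨_, h⟩
    rw [sub_add_cancel_left, L.weierstrassP_neg] at this
    exact hne' (by rw [← hsub, this, sub_self])
  have h := L.derivWeierstrassP_div_eq hv hx n1 n2
  rw [hsub, ← hwP] at h
  -- This shift replaces `x + b - 2ω` by `x + b` and produces the term `2ζ(ω)`.
  have hz := L.weierstrassZeta_add_two_mul hω hω2 n2
  rw [show x - ω + (b - ω) + 2 * ω = x + b by ring] at hz
  rw [sub_sub_sub_cancel_right] at n1 h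
  have n2' : x + b ∉ L.lattice := by
    rwa [show x + b = x - ω + (b - ω) + 2 * ω by ring, L.add_mem_lattice_iff hω2]
  refine ⟨n1, n2', ?_⟩
  have h' : L.weierstrassZeta (x - b) - L.weierstrassZeta (x + b) +
      2 * (L.weierstrassZeta ω + L.weierstrassZeta (b - ω)) = wPlus / (u - 1) := by
    rw [hz, h]; ring
  rw [h', show L.weierstrassP (x - ω) = u - e₁ / 3 by rw [hu]; ring]
  field_simp
  ring

/-- The branch is the integral of its logarithmic derivative. The quotient `σ(x - b)/σ(x + b)` times
`exp(-ℓ)` is constant, and since `σ` is odd its value at `x = 0` is `-1`, hence the minus sign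
inside the logarithm. -/
theorem exists_logBranch (h₁ : -e₄ < e₁) (h₂ : e₁ < e₄)
    (hmem : ∀ τ ∈ Icc (0 : ℝ) 1, γ.x τ - b ∉ L.lattice ∧ γ.x τ + b ∉ L.lattice) :
    ∃ ℓ : ℝ → ℂ, ℓ 0 = 0 ∧
      (∀ τ ∈ Icc (0 : ℝ) 1, HasDerivWithinAt ℓ ((L.weierstrassZeta (γ.x τ - b) -
        L.weierstrassZeta (γ.x τ + b)) * γ.rate τ) (Icc 0 1) τ) ∧
      ∀ T ∈ Icc (0 : ℝ) 1, Complex.exp (ℓ T) =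
        -(L.weierstrassSigma (γ.x T - b) / L.weierstrassSigma (γ.x T + b)) := by
  have dx := fun τ hτ => γ.hasDerivWithinAt_x h₁ h₂ (τ := τ) hτ
  have hc : ContinuousOn (fun τ => (L.weierstrassZeta (γ.x τ - b) -
      L.weierstrassZeta (γ.x τ + b)) * γ.rate τ) (Icc 0 1) := by
    refine ContinuousOn.mul (fun τ hτ => ?_) (γ.continuousOn_rate h₁ h₂)
    have c1 := (L.hasDerivAt_weierstrassZeta (hmem τ hτ).1).comp_hasDerivWithinAt τ
      ((dx τ hτ).sub_const b)
    have c2 := (L.hasDerivAt_weierstrassZeta (hmem τ hτ).2).comp_hasDerivWithinAt τ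
      ((dx τ hτ).add_const b)
    exact c1.continuousWithinAt.sub c2.continuousWithinAt
  have dℓ := fun τ hτ => hasDerivWithinAt_integral_Icc hc (τ := τ) hτ
  refine ⟨_, intervalIntegral.integral_same, dℓ, fun T hT => ?_⟩
  set ℓ : ℝ → ℂ := fun T => ∫ τ in (0 : ℝ)..T, (L.weierstrassZeta (γ.x τ - b) -
    L.weierstrassZeta (γ.x τ + b)) * γ.rate τ with hℓ
  have hconst := eq_of_hasDerivWithinAt_zero (g := fun τ => L.weierstrassSigma (γ.x τ - b) /
    L.weierstrassSigma (γ.x τ + b) * Complex.exp (-ℓ τ)) (fun τ hτ => ?_) hT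
  · have hb : L.weierstrassSigma b ≠ 0 := by
      have := (hmem 0 (left_mem_Icc.mpr zero_le_one)).2
      rw [γ.x_zero, zero_add] at this
      exact L.weierstrassSigma_ne_zero this
    have h0 : ℓ 0 = 0 := intervalIntegral.integral_same
    simp only [γ.x_zero, h0, zero_sub, zero_add, L.weierstrassSigma_neg, neg_zero,
      Complex.exp_zero, mul_one, neg_div, div_self hb, Complex.exp_neg] at hconst
    have hE := Complex.exp_ne_zero (ℓ T)
    rw [← div_eq_mul_inv, div_eq_iff hE] at hconst
    rw [hconst]; ring
  · obtain ⟨n1, n2⟩ := hmem τ hτ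
    have d1 := (L.hasDerivAt_weierstrassSigma n1).comp_hasDerivWithinAt τ ((dx τ hτ).sub_const b)
    have d2 := (L.hasDerivAt_weierstrassSigma n2).comp_hasDerivWithinAt τ ((dx τ hτ).add_const b)
    have hs := L.weierstrassSigma_ne_zero n2
    refine ((d1.div d2 hs).mul (dℓ τ hτ).neg.cexp).congr_deriv ?_
    simp only [Function.comp_apply, Pi.div_apply]
    field_simp
    ring

/-- The formula for the time integral on a lattice that uniformizes the curve. -/
theorem time_formula (h₁ : -e₄ < e₁) (h₂ : e₁ < e₄)
    (hω : ω ∉ L.lattice) (hω2 : 2 * ω ∈ L.lattice) (hP : L.weierstrassP ω = 2 * e₁ / 3)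
    (hg : L.g₂ = 4 * ((e₁ : ℂ) ^ 2 / 3 + (e₄ : ℂ) ^ 2)) (hw : wPlus ≠ 0)
    (hv : b - ω ∉ L.lattice) (hu1 : (1 : ℂ) = L.weierstrassP (b - ω) + e₁ / 3)
    (hwP : wPlus = L.derivWeierstrassP (b - ω)) (hγ : ∀ τ ∈ Icc (0 : ℝ) 1, γ.u τ ≠ 1) :
    ∃ ℓ : ℝ → ℂ, ContinuousOn ℓ (Icc 0 1) ∧ ℓ 0 = 0 ∧
      (∀ T ∈ Icc (0 : ℝ) 1, Complex.exp (ℓ T) =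
        -(L.weierstrassSigma (γ.x T - b) / L.weierstrassSigma (γ.x T + b))) ∧
      ∀ T ∈ Icc (0 : ℝ) 1, γ.abelianIntegral (fun u => (u ^ 2 - (e₄ : ℂ) ^ 2) / (u - 1)) T =
        -L.weierstrassZeta (γ.x T - ω) - L.weierstrassZeta ω + (1 + (e₁ : ℂ) / 3) * γ.x T
          + (1 - (e₄ : ℂ) ^ 2) / wPlus * (ℓ T
            + 2 * (L.weierstrassZeta ω + L.weierstrassZeta (b - ω)) * γ.x T) := by
  have hun := fun τ hτ => γ.mem_uniformizedSet L h₁ h₂ hω hω2 hP hg (τ := τ) hτ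
  have hint := fun τ hτ => time_integrand_eq (e₁ := e₁) (e₄ := e₄) L hω hω2 hw hv hu1 hwP
    (hun τ hτ).1 (hun τ hτ).2.1 (hγ τ hτ)
  obtain ⟨ℓ, hℓ0, dℓ, hexp⟩ := γ.exists_logBranch L h₁ h₂
    fun τ hτ => ⟨(hint τ hτ).1, (hint τ hτ).2.1⟩
  refine ⟨ℓ, fun τ hτ => (dℓ τ hτ).continuousWithinAt, hℓ0, hexp, fun T hT => ?_⟩
  have hf : ContinuousOn (fun τ => (γ.u τ ^ 2 - (e₄ : ℂ) ^ 2) / (γ.u τ - 1)) (Icc 0 1) := by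
    have := γ.contDiffOn_u.continuousOn
    exact ContinuousOn.div (by fun_prop) (by fun_prop) fun τ hτ => sub_ne_zero.mpr (hγ τ hτ)
  have hconst := eq_of_hasDerivWithinAt_zero (g := fun τ =>
    γ.abelianIntegral (fun u => (u ^ 2 - (e₄ : ℂ) ^ 2) / (u - 1)) τ -
      (-L.weierstrassZeta (γ.x τ - ω) - L.weierstrassZeta ω + (1 + (e₁ : ℂ) / 3) * γ.x τ
          + (1 - (e₄ : ℂ) ^ 2) / wPlus * (ℓ τ
            + 2 * (L.weierstrassZeta ω + L.weierstrassZeta (b - ω)) * γ.x τ)))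
    (fun τ hτ => ?_) hT
  -- At `x = 0` the right side vanishes because `-ζ(-ω) - ζ(ω) = 0`; this is the role of the
  -- constant `-ζ(ω)`.
  · simp only [γ.abelianIntegral_zero, γ.x_zero, hℓ0, zero_sub, L.weierstrassZeta_neg, neg_neg,
      sub_self, mul_zero, add_zero] at hconst
    exact sub_eq_zero.mp hconst
  · have dx := γ.hasDerivWithinAt_x h₁ h₂ hτ
    have dI := γ.hasDerivWithinAt_abelianIntegral h₁ h₂
      (f := fun u => (u ^ 2 - (e₄ : ℂ) ^ 2) / (u - 1)) hf hτ
    have dζ := (L.hasDerivAt_weierstrassZeta (hun τ hτ).1).comp_hasDerivWithinAt τ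
      (dx.sub_const ω)
    have d := dI.sub (((dζ.neg.sub_const (L.weierstrassZeta ω)).add
      (dx.const_mul (1 + (e₁ : ℂ) / 3))).add (((dℓ τ hτ).add (dx.const_mul
        (2 * (L.weierstrassZeta ω + L.weierstrassZeta (b - ω))))).const_mul
          ((1 - (e₄ : ℂ) ^ 2) / wPlus)))
    refine d.congr_deriv ?_
    rw [(hint τ hτ).2.2]
    ring

end CurvePath

end AperiodicTop

/-! ### The final formula for arbitrary orientations of the cycles. -/

theorem mainTheorem6 (s e₁ e₄ : ℝ) (hs : 0 < s) (he₁ : -1 ≤ e₁) (he₁' : e₁ < 1) (he₄ : 1 < e₄)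
    -- the half periods, with arbitrary orientations of the two cycles
    (L : PeriodPair) (hL : L = AperiodicTop.periods e₁ e₄ (by linarith) (by linarith))
    (ω₁ ω₂ ω₃ : ℂ) (hω₁ : ω₁ = L.ω₁ / 2 ∨ ω₁ = -(L.ω₁ / 2))
    (hω₂ : ω₂ = L.ω₂ / 2 ∨ ω₂ = -(L.ω₂ / 2)) (hω₃ : ω₃ = ω₁ + ω₂)
    -- the point `b` of the `x`-plane corresponds to a point `(1, wPlus)` of the curve
    (wPlus b : ℂ) (δ : AperiodicTop.CurvePath e₁ e₄) (hδu : δ.u 1 = 1) (hδw : δ.w 1 = wPlus)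
    (hb : b = δ.x 1)
    -- the path of integration, avoiding the points over `u = 1`
    (γ : AperiodicTop.CurvePath e₁ e₄) (hγ : ∀ τ ∈ Set.Icc (0 : ℝ) 1, γ.u τ ≠ 1) :
    IntervalIntegrable (δ.density fun _ => 1) MeasureTheory.volume 0 1 ∧
    IntervalIntegrable (γ.density fun _ => 1) MeasureTheory.volume 0 1 ∧
    IntervalIntegrable (γ.density fun u => (u ^ 2 - (e₄ : ℂ) ^ 2) / (u - 1))
      MeasureTheory.volume 0 1 ∧
    -- the branch, continued along the path, of the logarithm that vanishes at `x = 0`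
    ∃ logBranch : ℝ → ℂ, ContinuousOn logBranch (Set.Icc 0 1) ∧ logBranch 0 = 0 ∧
      (∀ T ∈ Set.Icc (0 : ℝ) 1, Complex.exp (logBranch T) =
        -(L.weierstrassSigma (γ.x T - b) / L.weierstrassSigma (γ.x T + b))) ∧
      ∀ T ∈ Set.Icc (0 : ℝ) 1,
        γ.time s T / (Complex.I * (Real.sqrt (2 * s) : ℂ)) =
          -L.weierstrassZeta (γ.x T - ω₃) - L.weierstrassZeta ω₃ + (1 + (e₁ : ℂ) / 3) * γ.x T
          + (1 - (e₄ : ℂ) ^ 2) / wPlus *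
            (logBranch T
              + 2 * (L.weierstrassZeta ω₃ + L.weierstrassZeta (b - ω₃)) * γ.x T) := by
  have h₁ : -e₄ < e₁ := by linarith
  have h₂ : e₁ < e₄ := by linarith
  obtain ⟨hP₀, hg⟩ := AperiodicTop.periods_uniformize h₁ h₂
  rw [← hL] at hP₀ hg
  have hL₁ : L.ω₁ = 2 * (Complex.I * AperiodicTop.imagHalfPeriod e₁ e₄) := by rw [hL]; rfl
  have hL₂ : L.ω₂ = 2 * AperiodicTop.realHalfPeriod e₁ e₄ := by rw [hL]; rfl
  rw [show (AperiodicTop.realHalfPeriod e₁ e₄ : ℂ) + AperiodicTop.imagHalfPeriod e₁ e₄ * Complex.I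
    = L.ω₁ / 2 + L.ω₂ / 2 by rw [hL₁, hL₂]; ring] at hP₀
  have hn₀ : L.ω₁ / 2 + L.ω₂ / 2 ∉ L.lattice := by
    have := (L.mul_ω₁_add_mul_ω₂_mem_lattice (α := 1 / 2) (β := 1 / 2)).not.mpr (by norm_num)
    convert! this using 2
    push_cast
    ring
  have m₁ := L.ω₁_mem_lattice
  have m₂ := L.ω₂_mem_lattice
  -- A change of sign moves `ω₃` by a period, so every choice gives the same value of `℘` there.
  have hd : L.ω₁ / 2 + L.ω₂ / 2 - ω₃ ∈ L.lattice := by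
    subst hω₃
    rcases hω₁ with rfl | rfl <;> rcases hω₂ with rfl | rfl
    · convert! L.lattice.zero_mem using 1; ring
    · convert! m₂ using 1; ring
    · convert! m₁ using 1; ring
    · convert! add_mem m₁ m₂ using 1; ring
  have hω : ω₃ ∉ L.lattice := fun h ↦ hn₀ (by simpa using add_mem hd h)
  have hω2 : 2 * ω₃ ∈ L.lattice := by
    have := sub_mem (add_mem m₁ m₂) (add_mem hd hd)
    convert! this using 1; ring
  have hP : L.weierstrassP ω₃ = 2 * e₁ / 3 := by
    have := L.weierstrassP_sub_coe (L.ω₁ / 2 + L.ω₂ / 2) ⟨_, hd⟩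
    rw [← hP₀, ← this, sub_sub_cancel]
  have one_mem : (1 : ℝ) ∈ Set.Icc (0 : ℝ) 1 := ⟨zero_le_one, le_rfl⟩
  -- Uniformizing the endpoint of `δ` identifies `1` and `wPlus` with the values of `℘ + e₁/3` and
  -- `℘'` at `b - ω₃`.
  obtain ⟨hv, hu1, hwP⟩ := δ.mem_uniformizedSet L h₁ h₂ hω hω2 hP hg one_mem
  rw [hδu, ← hb] at hu1
  rw [hδw, ← hb] at hwP
  rw [← hb] at hv
  -- The point over `u = 1` is not a branch point, because `R(1) = 4(1 - e₁)(1 - e₄²) < 0`.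
  have hw : wPlus ≠ 0 := by
    rintro rfl
    have h := δ.mem_curve 1 one_mem
    rw [hδw, hδu, AperiodicTop.cubic] at h
    have h' : (0 : ℝ) = 4 * (1 - e₁) * (1 - e₄ ^ 2) := by
      have : ((0 : ℝ) : ℂ) = ((4 * (1 - e₁) * (1 - e₄ ^ 2) : ℝ) : ℂ) := by
        push_cast
        linear_combination h
      exact_mod_cast this
    have : 0 < (1 - e₁) * (e₄ ^ 2 - 1) := mul_pos (by linarith) (by nlinarith)
    linarith
  obtain ⟨ℓ, hc, h0, hexp, hform⟩ := γ.time_formula L h₁ h₂ hω hω2 hP hg hw hv hu1 hwP hγ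
  have hf : ContinuousOn (fun τ => (γ.u τ ^ 2 - (e₄ : ℂ) ^ 2) / (γ.u τ - 1)) (Set.Icc 0 1) := by
    have := γ.contDiffOn_u.continuousOn
    exact ContinuousOn.div (by fun_prop) (by fun_prop) fun τ hτ => sub_ne_zero.mpr (hγ τ hτ)
  refine ⟨δ.intervalIntegrable_density h₁ h₂ continuousOn_const,
    γ.intervalIntegrable_density h₁ h₂ continuousOn_const,
    γ.intervalIntegrable_density h₁ h₂ hf, ℓ, hc, h0, hexp, fun T hT => ?_⟩
  rw [← hform T hT, AperiodicTop.CurvePath.time]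
  have hs' : (Real.sqrt (2 * s) : ℂ) ≠ 0 := by
    exact_mod_cast (Real.sqrt_pos.mpr (by positivity)).ne'
  exact mul_div_cancel_left₀ _ (mul_ne_zero Complex.I_ne_zero hs')
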